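/- Let $\mathbb{T}=\mathbb{R}/\mathbb{Z}$ carry Lebesgue measure and let $\|x\|$ denote the distance of $x$ to the nearest integer. Let $\alpha=[a_0;a_1,a_2,\dots]$ be an irrational number with bounded partial quotients, $Tx=x+\alpha$ the rotation of $\mathbb{T}$ by $\alpha$, and $C=\sup\{a_n:n\ge 1\}+1$. Let $f:\mathbb{T}\to\mathbb{R}$ be positive and bounded away from zero, and piecewise absolutely continuous: there are $k\ge 1$ and distinct points $\beta_1,\dots,\beta_k\in\mathbb{T}$ in cyclic order such that $f$ is absolutely continuous on each open arc $(\beta_j,\beta_{j+1})$, $1\le j\le k$, where $\beta_{k+1}=\beta_1$ (for $k=1$ the only arc is $\mathbb{T}\setminus\{\beta_1\}$). Put $d_j=\lim_{y\to\beta_j^-}f(y)-\lim_{y\to\beta_j^+}f(y)$ and suppose that the sum of jumps $S=\sum_{j=1}^k d_j$ is non-zero. Let $$D=\{n_1d_1+\dots+n_kd_k:\ n_j\in\mathbb{Z},\ 0\le n_j\le 2C+1\}.$$ Let $T^f=(T^f_t)_{t\in\mathbb{R}}$ be the special flow over $T$ under $f$: on $\mathbb{T}^f=\{(x,s):0\le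 s<f(x)\}$ it is given by $T^f_t(x,s)=(T^nx,\,s+t-f^{(n)}(x))$, where $n\in\mathbb{Z}$ is the unique integer with $f^{(n)}(x)\le s+t<f^{(n+1)}(x)$; here $f^{(n)}(x)=\sum_{i=0}^{n-1}f(T^ix)$ for $n\ge 0$ and $f^{(n)}(x)=-\sum_{i=n}^{-1}f(T^{i}x)$ for $n<0$. The space $\mathbb{T}^f$ carries the metric $d((x,s),(y,t))=\|x-y\|+|s-t|$ and the probability measure $\mu$ obtained by normalizing the restriction of two-dimensional Lebesgue measure. For a flow $(S_t)_{t\in\mathbb{R}}$ on a metric space $(X,d)$ with a Borel probability measure $\mu$, a number $t_0\neq 0$ and a finite set $P\subset\mathbb{R}\setminus\{0\}$, the property $\mathrm{R}(t_0,P)$ means: for every $\varepsilon>0$ there is $\kappa>0$ such that for every $N\in\mathbb{N}$ there are $\delta>0$ and a Borel set $Z\subset X$ with $\mu(Z)>1-\varepsilon$ such that, whenever $x,x'\in Z$, $x'$ is not in the orbit of $x$ and $d(x,x')<\delta$, there are real numbers $M,L\ge N$ with $L/M\ge\kappa$ and some $p'\in P$ with $$\frac{\#\{n\in\mathbb{Z}\cap[M,M+L]:\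 d(S_{nt_0}x,\,S_{nt_0+p'}x')<\varepsilon\}}{L}>1-\varepsilon .$$ **Theorem.** For every $p\in(0,|S|)\setminus(D\cup(-D))$ and every $\gamma>0$, the special flow $T^f$ has the property $\mathrm{R}(\gamma,P)$ with $$P=(\operatorname{sgn}(S)\,p-D)\cup(-\operatorname{sgn}(S)\,p+D);$$ in particular $P$ is a finite set not containing $0$. -/

import Mathlib

open MeasureTheory Set Filter Topology

noncomputable section

/-! ### Special flows -/

/-- The cocycle `f⁽ᵐ⁾(x)`, `m ∈ ℤ`, generated by `f` over an invertible map `T`: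
`f(x) + ⋯ + f(T^{m-1}x)` for `m > 0`, `0` for `m = 0`, and
`-(f(T^m x) + ⋯ + f(T^{-1}x))` for `m < 0`. -/
def birkhoffCocycle {X : Type*} (T : Equiv.Perm X) (f : X → ℝ) : ℤ → X → ℝ
  | Int.ofNat m, x => ∑ i ∈ Finset.range m, f ((T ^ (i : ℤ)) x)
  | Int.negSucc m, x => -∑ i ∈ Finset.range (m + 1), f ((T ^ (-((i : ℤ) + 1))) x)

theorem birkhoffCocycle_add_one {X : Type*} (T : Equiv.Perm X) (f : X → ℝ) (n : ℤ) (x : X) :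
    birkhoffCocycle T f (n + 1) x = birkhoffCocycle T f n x + f ((T ^ n) x) := by
  rcases n with m | m
  · have h : (Int.ofNat m + 1 : ℤ) = Int.ofNat (m + 1) := rfl
    rw [h]
    simp [birkhoffCocycle, Finset.sum_range_succ]
  · rcases m with _ | m
    · have h : (Int.negSucc 0 + 1 : ℤ) = Int.ofNat 0 := rfl
      rw [h]
      simp [birkhoffCocycle]
    · have h : (Int.negSucc (m + 1) + 1 : ℤ) = Int.negSucc m := by
        simp only [Int.negSucc_eq]; push_cast; ring
      have h' : (Int.negSucc (m + 1) : ℤ) = -(((m + 1 : ℕ) : ℤ) + 1) := by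
        simp only [Int.negSucc_eq]
      rw [h]
      simp only [birkhoffCocycle]
      rw [Finset.sum_range_succ _ (m + 1), h']
      ring

theorem birkhoffCocycle_zero {X : Type*} (T : Equiv.Perm X) (f : X → ℝ) (x : X) :
    birkhoffCocycle T f 0 x = 0 := by
  change birkhoffCocycle T f (Int.ofNat 0) x = 0
  simp [birkhoffCocycle]

theorem birkhoffCocycle_lower {X : Type*} (T : Equiv.Perm X) {f : X → ℝ} {c : ℝ}
    (hc : ∀ x, c ≤ f x) (x : X) (m : ℤ) (k : ℕ) :
    birkhoffCocycle T f m x + k * c ≤ birkhoffCocycle T f (m + k) x := by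
  induction k with
  | zero => simp
  | succ k ih =>
    have h := birkhoffCocycle_add_one T f (m + k) x
    have h' := hc ((T ^ (m + k)) x)
    have e : m + ((k + 1 : ℕ) : ℤ) = m + k + 1 := by push_cast; ring
    rw [e, h]
    push_cast
    linarith

theorem birkhoffCocycle_lower_of_le {X : Type*} (T : Equiv.Perm X) {f : X → ℝ} {c : ℝ}
    (hc : ∀ x, c ≤ f x) (x : X) {m n : ℤ} (h : m ≤ n) :
    birkhoffCocycle T f m x + ((n - m : ℤ) : ℝ) * c ≤ birkhoffCocycle T f n x := by
  obtain ⟨k, rfl⟩ := Int.le.dest h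
  simpa using birkhoffCocycle_lower T hc x m k

/-- If `f` is bounded away from zero, every real `r` lies in exactly one of the intervals
`[f⁽ⁿ⁾(x), f⁽ⁿ⁺¹⁾(x))`, `n ∈ ℤ`. -/
theorem existsUnique_birkhoffCocycle {X : Type*} (T : Equiv.Perm X) {f : X → ℝ}
    (hf : ∃ c > 0, ∀ x, c ≤ f x) (x : X) (r : ℝ) :
    ∃! n : ℤ, birkhoffCocycle T f n x ≤ r ∧ r < birkhoffCocycle T f (n + 1) x := by
  obtain ⟨c, hc0, hc⟩ := hf
  obtain ⟨k, hk⟩ := exists_nat_gt (|r| / c)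
  rw [div_lt_iff₀ hc0] at hk
  have hbd : ∀ z : ℤ, birkhoffCocycle T f z x ≤ r → z ≤ k := by
    intro z hz
    by_contra! hlt
    have h0 := birkhoffCocycle_lower_of_le T hc x (m := 0) (n := z) (by omega)
    rw [birkhoffCocycle_zero] at h0
    have h1 : (k : ℝ) ≤ ((z - 0 : ℤ) : ℝ) := by
      rw [sub_zero]; exact_mod_cast hlt.le
    have h2 := mul_le_mul_of_nonneg_right h1 hc0.le
    have h3 := le_abs_self r
    linarith
  have hne : ∃ z : ℤ, birkhoffCocycle T f z x ≤ r := by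
    refine ⟨-k, ?_⟩
    have h0 := birkhoffCocycle_lower T hc x (-k) k
    rw [neg_add_cancel, birkhoffCocycle_zero] at h0
    have h3 := neg_abs_le r
    linarith
  obtain ⟨n, hn, hmax⟩ := Int.exists_greatest_of_bdd ⟨k, hbd⟩ hne
  refine ⟨n, ⟨hn, ?_⟩, ?_⟩
  · by_contra! h
    have := hmax _ h
    omega
  · rintro m ⟨hm1, hm2⟩
    refine le_antisymm (hmax m hm1) ?_
    by_contra! hlt
    have h0 := birkhoffCocycle_lower_of_le T hc x (m := m + 1) (n := n) (by omega)
    have h1 : (0 : ℝ) ≤ ((n - (m + 1) : ℤ) : ℝ) := by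
      exact_mod_cast (by omega : (0 : ℤ) ≤ n - (m + 1))
    have h2 := mul_nonneg h1 hc0.le
    linarith

/-- The phase space `X^f = {(x, s) : 0 ≤ s < f(x)}` of the special flow under `f`. -/
def SpecialSpace {X : Type*} (f : X → ℝ) : Type _ :=
  {q : X × ℝ // 0 ≤ q.2 ∧ q.2 < f q.1}

namespace SpecialSpace

variable {X : Type*} {f : X → ℝ}

instance [TopologicalSpace X] : TopologicalSpace (SpecialSpace f) :=
  inferInstanceAs (TopologicalSpace {q : X × ℝ // 0 ≤ q.2 ∧ q.2 < f q.1})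

/-- The trace on `X^f` of the product σ-algebra. -/
instance [MeasurableSpace X] : MeasurableSpace (SpecialSpace f) :=
  inferInstanceAs (MeasurableSpace {q : X × ℝ // 0 ≤ q.2 ∧ q.2 < f q.1})

instance [TopologicalSpace X] [SecondCountableTopology X] [MeasurableSpace X] [BorelSpace X] :
    BorelSpace (SpecialSpace f) :=
  inferInstanceAs (BorelSpace {q : X × ℝ // 0 ≤ q.2 ∧ q.2 < f q.1})

/-- The metric `d((x, s), (y, t)) = d(x, y) + |s - t|` on `X^f`. -/
instance [MetricSpace X] : MetricSpace (SpecialSpace f) :=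
  MetricSpace.ofDistTopology (fun q r => dist q.1.1 r.1.1 + |q.1.2 - r.1.2|)
    (fun q => by simp)
    (fun q r => by rw [dist_comm, abs_sub_comm])
    (fun q r s => by
      have h1 := dist_triangle q.1.1 r.1.1 s.1.1
      have h2 := abs_sub_le q.1.2 r.1.2 s.1.2
      linarith)
    (fun s => by
      constructor
      · rintro hs x hx
        obtain ⟨u, hu, rfl⟩ := isOpen_induced_iff.1 hs
        obtain ⟨ε, hε, h⟩ := Metric.isOpen_iff.1 hu x.1 hx
        refine ⟨ε, hε, fun y hy => h ?_⟩
        rw [Metric.mem_ball, Prod.dist_eq, dist_comm y.1.1, Real.dist_eq, abs_sub_comm]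
        exact max_lt (by linarith [abs_nonneg (x.1.2 - y.1.2)])
          (by linarith [dist_nonneg (x := x.1.1) (y := y.1.1)])
      · intro h
        rw [isOpen_iff_mem_nhds]
        intro x hx
        obtain ⟨ε, hε, h'⟩ := h x hx
        refine mem_nhds_induced Subtype.val x s |>.2
          ⟨Metric.ball x.1 (ε / 2), Metric.ball_mem_nhds _ (by positivity), fun y hy => h' y ?_⟩
        have hy' : dist y.1 x.1 < ε / 2 := hy
        rw [Prod.dist_eq, dist_comm y.1.1, Real.dist_eq, abs_sub_comm] at hy'
        have h1 := le_max_left (dist x.1.1 y.1.1) |x.1.2 - y.1.2|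
        have h2 := le_max_right (dist x.1.1 y.1.1) |x.1.2 - y.1.2|
        linarith)
    (fun q r h => by
      have h1 : dist q.1.1 r.1.1 = 0 := by
        linarith [abs_nonneg (q.1.2 - r.1.2), dist_nonneg (x := q.1.1) (y := r.1.1)]
      have h2 : |q.1.2 - r.1.2| = 0 := by
        linarith [abs_nonneg (q.1.2 - r.1.2), dist_nonneg (x := q.1.1) (y := r.1.1)]
      exact Subtype.ext (Prod.ext (dist_eq_zero.1 h1) (sub_eq_zero.1 (abs_eq_zero.1 h2))))

theorem dist_def [MetricSpace X] (q r : SpecialSpace f) :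
    dist q r = dist q.1.1 r.1.1 + |q.1.2 - r.1.2| := rfl

end SpecialSpace

/-- The measure `μ^f`: the restriction to `X^f` of the product of `μ` with Lebesgue measure. -/
def specialMeasure {X : Type*} [MeasurableSpace X] (μ : Measure X) (f : X → ℝ) :
    Measure (SpecialSpace f) :=
  (μ.prod (volume : Measure ℝ)).comap Subtype.val

/-- The measure `μ^f` divided by its total mass `∫ f dμ`. -/
def normalizedSpecialMeasure {X : Type*} [MeasurableSpace X] (μ : Measure X) (f : X → ℝ) :
    Measure (SpecialSpace f) :=
  (specialMeasure μ f univ)⁻¹ • specialMeasure μ f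

/-- The special flow `T^f`: `T^f_t(x, s) = (Tⁿx, s + t - f⁽ⁿ⁾(x))`, where `n` is the unique
integer with `f⁽ⁿ⁾(x) ≤ s + t < f⁽ⁿ⁺¹⁾(x)`. -/
def specialFlow {X : Type*} (T : Equiv.Perm X) (f : X → ℝ) (hf : ∃ c > 0, ∀ x, c ≤ f x)
    (t : ℝ) (q : SpecialSpace f) : SpecialSpace f :=
  let n := (existsUnique_birkhoffCocycle T hf q.1.1 (q.1.2 + t)).choose
  have hn := (existsUnique_birkhoffCocycle T hf q.1.1 (q.1.2 + t)).choose_spec.1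
  ⟨((T ^ n) q.1.1, q.1.2 + t - birkhoffCocycle T f n q.1.1),
    sub_nonneg.2 hn.1, by
      have h := hn.2
      rw [birkhoffCocycle_add_one] at h
      change q.1.2 + t - birkhoffCocycle T f n q.1.1 < f ((T ^ n) q.1.1)
      linarith⟩

theorem specialFlow_val_of_mem {X : Type*} (T : Equiv.Perm X) (f : X → ℝ)
    (hf : ∃ c > 0, ∀ x, c ≤ f x) (t : ℝ) (q : SpecialSpace f) (n : ℤ)
    (h1 : birkhoffCocycle T f n q.1.1 ≤ q.1.2 + t)
    (h2 : q.1.2 + t < birkhoffCocycle T f (n + 1) q.1.1) :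
    (specialFlow T f hf t q).1 =
      ((T ^ n) q.1.1, q.1.2 + t - birkhoffCocycle T f n q.1.1) := by
  have h := (existsUnique_birkhoffCocycle T hf q.1.1 (q.1.2 + t)).choose_spec.2 n ⟨h1, h2⟩
  rw [h]
  rfl

/-- The rotation `x ↦ x + α` of the circle `ℝ/ℤ`. -/
def circleRotation (α : ℝ) : Equiv.Perm UnitAddCircle :=
  Equiv.addRight (α : UnitAddCircle)

/-! ### The Ratner-type property -/

/-- The property `R(t₀, P)` of a flow `S` on a metric space with a Borel probability measure `μ`.
The number `κ` depends on `ε` only, while `δ` and `Z` depend on `ε` and `N`. -/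
structure RatnerProperty {X : Type*} [MetricSpace X] [MeasurableSpace X] [BorelSpace X]
    (S : ℝ → X → X) (μ : Measure X) (t₀ : ℝ) (P : Set ℝ) : Prop where
  time_ne_zero : t₀ ≠ 0
  finite : P.Finite
  zero_notMem : (0 : ℝ) ∉ P
  drift : ∀ ε > (0 : ℝ), ∃ κ > (0 : ℝ), ∀ N : ℕ, ∃ δ > (0 : ℝ), ∃ Z : Set X,
    MeasurableSet Z ∧ 1 - ε < μ.real Z ∧
    ∀ x ∈ Z, ∀ x' ∈ Z, (∀ t : ℝ, S t x ≠ x') → dist x x' < δ →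
      ∃ M L : ℝ, N ≤ M ∧ N ≤ L ∧ κ ≤ L / M ∧ ∃ p ∈ P,
        1 - ε < ({n : ℤ | M ≤ n ∧ n ≤ M + L ∧
          dist (S (n * t₀) x) (S (n * t₀ + p) x') < ε}.ncard : ℝ) / L

/-! ### Continued fractions -/

/-- The set of partial quotients `a₁, a₂, …` of `α = [a₀; a₁, a₂, …]`; the integer part `a₀` is
not included. -/
def partialQuotients (α : ℝ) : Set ℝ :=
  {a | ∃ n : ℕ, (GenContFract.of α).partDens.get? n = some a}

/-! ### Piecewise absolutely continuous functions on the circle -/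

/-- Absolute continuity of `g` on the open interval `(a, b)`: the usual `ε`-`δ` condition over all
finite families of disjoint intervals with endpoints in `(a, b)`. -/
def AbsolutelyContinuousOnIoo (g : ℝ → ℝ) (a b : ℝ) : Prop :=
  ∀ ε > (0 : ℝ), ∃ δ > (0 : ℝ), ∀ E ∈ AbsolutelyContinuousOnInterval.disjWithin a b,
    (∀ i ∈ Finset.range E.1, (E.2 i).1 ∈ Ioo a b ∧ (E.2 i).2 ∈ Ioo a b) →
    ∑ i ∈ Finset.range E.1, dist (E.2 i).1 (E.2 i).2 < δ →
    ∑ i ∈ Finset.range E.1, dist (g (E.2 i).1) (g (E.2 i).2) < ε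

/-- `f` is absolutely continuous on each of the `k` consecutive open arcs into which the circle is
cut by `k` points. The points are given in cyclic order through real lifts
`β 0 < β 1 < ⋯ < β k = β 0 + 1`, so that `β k` and `β 0` are the same point of the circle. -/
structure IsPiecewiseAbsolutelyContinuous (f : UnitAddCircle → ℝ) {k : ℕ}
    (β : Fin (k + 1) → ℝ) : Prop where
  strictMono : StrictMono β
  last_eq : β (Fin.last k) = β 0 + 1
  absolutelyContinuous : ∀ j : Fin k,
    AbsolutelyContinuousOnIoo (fun t : ℝ => f (t : UnitAddCircle)) (β j.castSucc) (β j.succ)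

/-- The jump `f₋(b) - f₊(b)`, left limit minus right limit, of `f` at the point `b` of the
circle. -/
def jump (f : UnitAddCircle → ℝ) (b : ℝ) : ℝ :=
  Function.leftLim (fun t : ℝ => f (t : UnitAddCircle)) b -
    Function.rightLim (fun t : ℝ => f (t : UnitAddCircle)) b

/-- The sum of jumps `S(f) = d₁ + ⋯ + d_k`. -/
def sumOfJumps (f : UnitAddCircle → ℝ) {k : ℕ} (β : Fin (k + 1) → ℝ) : ℝ :=
  ∑ j : Fin k, jump f (β j.castSucc)

/-- The set `D = {n₁d₁ + ⋯ + n_kd_k : 0 ≤ n₁, …, n_k ≤ 2C + 1}`, where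
`C = sup {a₁, a₂, …} + 1`. -/
def jumpSums (α : ℝ) (f : UnitAddCircle → ℝ) {k : ℕ} (β : Fin (k + 1) → ℝ) : Set ℝ :=
  {x | ∃ n : Fin k → ℕ, (∀ j, (n j : ℝ) ≤ 2 * (sSup (partialQuotients α) + 1) + 1) ∧
    x = ∑ j : Fin k, n j * jump f (β j.castSucc)}

end

/-! Compare base points x and x + a with a > 0 small. Off the discontinuities `f` is an integral of
f' plus a step function, so f⁽ⁿ⁾(x + a) - f⁽ⁿ⁾(x) equals the integral of f' over the n arcs from x +
iα to x + a + iα, minus ∑ c_j(n) d_j, where c_j(n) counts the arcs that contain β_j (`sum_sub_sum`).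
Periodicity of `f` forces ∫ f' = S. Bounded partial quotients imply that up to time 1/a these arcs
cover each point at most 2C + 1 times. This bounds every c_j(n) by 2C + 1, and it also allows f' to
be replaced by an L¹-close trigonometric polynomial, so that the integral term is naS up to a small
error uniform in x (`exists_drift_bound`).

Near the time p/(|S|a), which is below 1/a because p < |S|, the integral term is close to sgn(S)p.
The counts c_j are monotone and bounded, so if this range of times is cut into a fixed number of
blocks, no count changes on one of them; there the difference is frozen near sgn(S)p - d with d ∈ D
(`exists_window`). The block length is at least a fixed fraction of its starting time, which yields
κ. Exchanging the two points gives the opposite values.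

For the flow, a frozen difference p' keeps the two orbits close after the shift p', except at times
nγ at which the first orbit is near the base or the roof. Such times inject into the visits of the
skew product (x, θ) ↦ (x + α, θ - f(x)) to a thin strip around θ = 0 modulo γ (`le_ncard_close`). No
ergodicity of the skew product is available; the mean ergodic theorem and the maximal inequality
bound the visits in all late windows [M, M + L) with L ≥ κM, off a set of small measure
(`exists_visit_frequency_bound`). The order of choices is essential: the strip width is fixed before
κ, since κ depends on it, so the smallness demanded of the strip must not involve κ. -/

noncomputable section

/-! ### Continued fractions and separation of orbits of the rotation. -/

/-- The orbit of the fractional part of `α` under the Gauss map. -/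
def gaussOrbit (α : ℝ) : ℕ → ℝ
  | 0 => Int.fract α
  | n + 1 => Int.fract (gaussOrbit α n)⁻¹

theorem irrational_gaussOrbit {α : ℝ} (hα : Irrational α) (n : ℕ) :
    Irrational (gaussOrbit α n) := by
  induction n with
  | zero =>
    rw [gaussOrbit, Int.fract]
    exact hα.sub_intCast _
  | succ n ih =>
    rw [gaussOrbit, Int.fract]
    exact ih.inv.sub_intCast _

theorem gaussOrbit_pos {α : ℝ} (hα : Irrational α) (n : ℕ) : 0 < gaussOrbit α n := by
  have h1 : gaussOrbit α n ≠ 0 := (irrational_gaussOrbit hα n).ne_zero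
  have h2 : 0 ≤ gaussOrbit α n := by cases n <;> exact Int.fract_nonneg _
  exact lt_of_le_of_ne h2 h1.symm

theorem gaussOrbit_lt_one (α : ℝ) (n : ℕ) : gaussOrbit α n < 1 := by
  cases n <;> exact Int.fract_lt_one _

theorem stream_gaussOrbit {α : ℝ} (hα : Irrational α) (n : ℕ) :
    ∃ b : ℤ, GenContFract.IntFractPair.stream α n = some ⟨b, gaussOrbit α n⟩ := by
  induction n with
  | zero => exact ⟨⌊α⌋, rfl⟩
  | succ n ih =>
    obtain ⟨b, hb⟩ := ih
    refine ⟨⌊(gaussOrbit α n)⁻¹⌋, ?_⟩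
    rw [GenContFract.IntFractPair.stream_succ_of_some hb (irrational_gaussOrbit hα n).ne_zero]
    rfl

theorem floor_inv_gaussOrbit_mem_partialQuotients {α : ℝ} (hα : Irrational α) (n : ℕ) :
    ((⌊(gaussOrbit α n)⁻¹⌋ : ℤ) : ℝ) ∈ partialQuotients α := by
  obtain ⟨b, hb⟩ := stream_gaussOrbit hα n
  have h := GenContFract.IntFractPair.stream_succ_of_some hb (irrational_gaussOrbit hα n).ne_zero
  have h2 := GenContFract.get?_of_eq_some_of_succ_get?_intFractPair_stream h
  exact ⟨n, GenContFract.partDen_eq_s_b h2⟩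

/-- Denominators of the convergents. -/
def convDen (α : ℝ) : ℕ → ℤ
  | 0 => 1
  | 1 => ⌊(gaussOrbit α 0)⁻¹⌋
  | n + 2 => ⌊(gaussOrbit α (n + 1))⁻¹⌋ * convDen α (n + 1) + convDen α n

/-- Numerators of the convergents. -/
def convNum (α : ℝ) : ℕ → ℤ
  | 0 => ⌊α⌋
  | 1 => ⌊(gaussOrbit α 0)⁻¹⌋ * ⌊α⌋ + 1
  | n + 2 => ⌊(gaussOrbit α (n + 1))⁻¹⌋ * convNum α (n + 1) + convNum α n

/-- The error `q_n α - p_n`. -/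
def convErr (α : ℝ) (n : ℕ) : ℝ := convDen α n * α - convNum α n

theorem one_le_floor_inv_gaussOrbit {α : ℝ} (hα : Irrational α) (n : ℕ) :
    1 ≤ ⌊(gaussOrbit α n)⁻¹⌋ := by
  rw [Int.le_floor]
  exact_mod_cast (one_lt_inv₀ (gaussOrbit_pos hα n)).2 (gaussOrbit_lt_one α n) |>.le

/-- The errors obey the recursion of the denominators, and one step of the Gauss map solves it. In
particular they alternate in sign and decrease in modulus. -/
theorem convErr_succ {α : ℝ} (hα : Irrational α) (n : ℕ) :
    convErr α (n + 1) = -gaussOrbit α (n + 1) * convErr α n := by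
  induction n with
  | zero =>
    have h0 := (gaussOrbit_pos hα 0).ne'
    have h1 : gaussOrbit α 1 = (gaussOrbit α 0)⁻¹ - ⌊(gaussOrbit α 0)⁻¹⌋ := rfl
    have h2 : gaussOrbit α 0 = α - ⌊α⌋ := rfl
    simp only [convErr, convDen, convNum, zero_add]
    rw [h1]
    push_cast
    rw [one_mul, ← h2]
    field_simp
    rw [h2]; ring
  | succ n ih =>
    have h0 := (gaussOrbit_pos hα (n + 1)).ne'
    have h1 : gaussOrbit α (n + 2) = (gaussOrbit α (n + 1))⁻¹ - ⌊(gaussOrbit α (n + 1))⁻¹⌋ := rfl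
    have h2 : convErr α (n + 2) =
        ⌊(gaussOrbit α (n + 1))⁻¹⌋ * convErr α (n + 1) + convErr α n := by
      simp only [convErr, convDen, convNum]; push_cast; ring
    have h3 : convErr α n = -(gaussOrbit α (n + 1))⁻¹ * convErr α (n + 1) := by
      rw [ih]; field_simp
    rw [show n + 1 + 1 = n + 2 from rfl, h2, h1, h3]
    ring

theorem one_le_convDen {α : ℝ} (hα : Irrational α) (n : ℕ) :
    1 ≤ convDen α n ∧ 1 ≤ convDen α (n + 1) ∧ convDen α n ≤ convDen α (n + 1) := by
  induction n with
  | zero =>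
    have h := one_le_floor_inv_gaussOrbit hα 0
    exact ⟨le_rfl, h, h⟩
  | succ n ih =>
    have h := one_le_floor_inv_gaussOrbit hα (n + 1)
    have e : convDen α (n + 1 + 1) =
      ⌊(gaussOrbit α (n + 1))⁻¹⌋ * convDen α (n + 1) + convDen α n := rfl
    refine ⟨ih.2.1, ?_, ?_⟩ <;> rw [e] <;> nlinarith

theorem natCast_le_convDen {α : ℝ} (hα : Irrational α) (n : ℕ) : (n : ℤ) ≤ convDen α n := by
  induction n using Nat.twoStepInduction with
  | zero => simp [convDen]
  | one => exact_mod_cast (one_le_convDen hα 0).2.1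
  | more n ih1 ih2 =>
    have h := one_le_floor_inv_gaussOrbit hα (n + 1)
    have e : convDen α (n + 2) =
      ⌊(gaussOrbit α (n + 1))⁻¹⌋ * convDen α (n + 1) + convDen α n := rfl
    have h1 := one_le_convDen hα n
    push_cast at *
    rw [e]; nlinarith

theorem convDen_mul_convNum_sub {α : ℝ} (n : ℕ) :
    |convDen α n * convNum α (n + 1) - convDen α (n + 1) * convNum α n| = 1 := by
  induction n with
  | zero =>
    simp [convDen, convNum]
  | succ n ih =>
    have e : convDen α (n + 1 + 1) =
      ⌊(gaussOrbit α (n + 1))⁻¹⌋ * convDen α (n + 1) + convDen α n := rfl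
    have e' : convNum α (n + 1 + 1) =
      ⌊(gaussOrbit α (n + 1))⁻¹⌋ * convNum α (n + 1) + convNum α n := rfl
    rw [e, e', ← ih, ← abs_neg]
    congr 1; ring

/-- Written through the errors, the determinant ±1 has two terms of the same sign, because
consecutive errors have opposite signs. -/
theorem abs_convErr_mul_add {α : ℝ} (hα : Irrational α) (n : ℕ) :
    convDen α (n + 1) * |convErr α n| + convDen α n * |convErr α (n + 1)| = 1 := by
  have h := convDen_mul_convNum_sub (α := α) n
  have hR : |(convDen α n * convNum α (n + 1) - convDen α (n + 1) * convNum α n : ℝ)| = 1 := by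
    exact_mod_cast h
  have h1 : (convDen α n * convNum α (n + 1) - convDen α (n + 1) * convNum α n : ℝ) =
      convDen α (n + 1) * convErr α n - convDen α n * convErr α (n + 1) := by
    simp only [convErr]; ring
  have hq := one_le_convDen hα n
  have hq1 : (0 : ℝ) < convDen α n := by exact_mod_cast hq.1
  have hq2 : (0 : ℝ) < convDen α (n + 1) := by exact_mod_cast hq.2.1
  have ht := gaussOrbit_pos hα (n + 1)
  have hq3 : (0 : ℝ) < convDen α (n + 1) + convDen α n * gaussOrbit α (n + 1) := by positivity
  rw [h1, convErr_succ hα] at hR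
  rw [convErr_succ hα, abs_mul, abs_neg, abs_of_pos ht, ← hR,
    show (convDen α (n + 1) * convErr α n - convDen α n * (-gaussOrbit α (n + 1) * convErr α n) : ℝ)
      = (convDen α (n + 1) + convDen α n * gaussOrbit α (n + 1)) * convErr α n by ring,
    abs_mul, abs_of_pos hq3]
  ring

/-- The convergents are best approximations of the second kind. -/
theorem abs_convErr_le {α : ℝ} (hα : Irrational α) (n : ℕ) {m : ℤ} (hm0 : 0 < m)
    (hm : m < convDen α (n + 1)) (r : ℤ) : |convErr α n| ≤ |m * α - r| := by
  obtain ⟨hq1, hq2, -⟩ := one_le_convDen hα n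
  have hdet := convDen_mul_convNum_sub (α := α) n
  set q := convDen α n
  set q' := convDen α (n + 1)
  set p := convNum α n
  set p' := convNum α (n + 1)
  -- Consecutive convergents form a matrix of determinant ±1, hence a basis of ℤ².
  obtain ⟨u, v, hu, hv⟩ : ∃ u v : ℤ, m = u * q + v * q' ∧ r = u * p + v * p' := by
    rcases (abs_eq one_pos.le).1 hdet with h | h
    · refine ⟨m * p' - r * q', r * q - m * p, ?_, ?_⟩
      · linear_combination (-m) * h
      · linear_combination (-r) * h
    · refine ⟨-(m * p' - r * q'), -(r * q - m * p), ?_, ?_⟩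
      · linear_combination m * h
      · linear_combination r * h
  have hsum : (m * α - r : ℝ) = (u - v * gaussOrbit α (n + 1)) * convErr α n := by
    have h1 : (m * α - r : ℝ) = u * convErr α n + v * convErr α (n + 1) := by
      rw [hu, hv]; simp only [convErr]; push_cast; ring
    rw [h1, convErr_succ hα]; ring
  have ht := gaussOrbit_pos hα (n + 1)
  rw [hsum, abs_mul]
  refine le_mul_of_one_le_left (abs_nonneg _) ?_
  -- The bounds 0 < m < q' force u and v to have opposite signs when v ≠ 0. The two errors have
  -- opposite signs as well, so their contributions add up.
  rcases lt_trichotomy v 0 with hv0 | hv0 | hv0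
  · have hu1 : 1 ≤ u := by
      by_contra! hlt
      nlinarith
    have hu' : (1 : ℝ) ≤ u := by exact_mod_cast hu1
    have hv' : (v : ℝ) < 0 := by exact_mod_cast hv0
    rw [le_abs]; left; nlinarith
  · have hu1 : u ≠ 0 := by
      rintro rfl
      subst hv0; omega
    have : (1 : ℝ) ≤ |(u : ℝ)| := by exact_mod_cast Int.one_le_abs hu1
    simpa [hv0] using this
  · have hu1 : u ≤ -1 := by
      by_contra! hlt
      nlinarith
    have hu' : (u : ℝ) ≤ -1 := by exact_mod_cast hu1
    have hv' : (0 : ℝ) < v := by exact_mod_cast hv0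
    rw [le_abs]; right; nlinarith

/-- The number `C = sup {a₁, a₂, …} + 1`. -/
def quotientBound (α : ℝ) : ℝ := sSup (partialQuotients α) + 1

/-- The `+ 1` in `C` absorbs the older denominator in the recursion, which is at most `convDen α n`.
-/
theorem convDen_succ_le {α : ℝ} (hα : Irrational α) (hb : BddAbove (partialQuotients α)) (n : ℕ) :
    (convDen α (n + 1) : ℝ) ≤ quotientBound α * convDen α n := by
  have h := le_csSup hb (floor_inv_gaussOrbit_mem_partialQuotients hα n)
  have hq := one_le_convDen hα n
  have hq1 : (1 : ℝ) ≤ convDen α n := by exact_mod_cast hq.1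
  unfold quotientBound
  cases n with
  | zero =>
    simp only [convDen] at *
    push_cast
    linarith
  | succ n =>
    have e : convDen α (n + 1 + 1) =
      ⌊(gaussOrbit α (n + 1))⁻¹⌋ * convDen α (n + 1) + convDen α n := rfl
    have h2 : (convDen α n : ℝ) ≤ convDen α (n + 1) := by exact_mod_cast (one_le_convDen hα n).2.2
    rw [e]; push_cast
    nlinarith

theorem two_le_quotientBound {α : ℝ} (hα : Irrational α) (hb : BddAbove (partialQuotients α)) :
    2 ≤ quotientBound α := by
  have h := le_csSup hb (floor_inv_gaussOrbit_mem_partialQuotients hα 0)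
  have h1 : (1 : ℝ) ≤ ((⌊(gaussOrbit α 0)⁻¹⌋ : ℤ) : ℝ) := by
    exact_mod_cast one_le_floor_inv_gaussOrbit hα 0
  unfold quotientBound
  linarith

/-- At every scale `a` there is a denominator `q` comparable to `1 / a` such that the first `q`
points of an orbit are `1 / (2q)`-separated. -/
theorem exists_separation {α : ℝ} (hα : Irrational α) (hb : BddAbove (partialQuotients α))
    {a : ℝ} (ha0 : 0 < a) (ha1 : a ≤ 1) :
    ∃ q : ℝ, 0 < q ∧ 1 / a < q ∧ a * q ≤ quotientBound α ∧
      ∀ m : ℤ, 0 < m → (m : ℝ) < q → ∀ r : ℤ, 1 / (2 * q) ≤ |m * α - r| := by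
  classical
  have hex : ∃ n : ℕ, 1 / a < convDen α n := by
    obtain ⟨n, hn⟩ := exists_nat_gt (1 / a)
    exact ⟨n, hn.trans_le (by exact_mod_cast natCast_le_convDen hα n)⟩
  -- The witness is the first denominator above 1/a. Its index is positive as `convDen α 0 = 1 ≤ 1 /
  -- a`; the preceding denominator is at most 1/a, whence a q ≤ C.
  obtain ⟨n, hn⟩ : ∃ n, Nat.find hex = n + 1 := by
    refine Nat.exists_eq_succ_of_ne_zero fun h0 => ?_
    have h := Nat.find_spec hex
    rw [h0] at h
    simp only [convDen, Int.cast_one] at h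
    have : 1 ≤ 1 / a := by rw [le_div_iff₀ ha0]; linarith
    linarith
  have h1 := Nat.find_spec hex
  have h2 : ¬ 1 / a < convDen α n := Nat.find_min hex (by omega)
  rw [hn] at h1
  rw [not_lt, le_div_iff₀ ha0] at h2
  have hq := one_le_convDen hα n
  have hq1 : (0 : ℝ) < convDen α n := by exact_mod_cast hq.1
  have hq2 : (0 : ℝ) < convDen α (n + 1) := by exact_mod_cast hq.2.1
  have hq3 : (convDen α n : ℝ) ≤ convDen α (n + 1) := by exact_mod_cast hq.2.2
  refine ⟨convDen α (n + 1), hq2, h1, ?_, ?_⟩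
  · have h3 := convDen_succ_le hα hb n
    have h4 := two_le_quotientBound hα hb
    nlinarith
  · intro m hm0 hm r
    refine le_trans ?_ (abs_convErr_le hα n hm0 (by exact_mod_cast hm) r)
    -- Of the two terms with sum 1 the first is the larger, so it is at least 1/2.
    have h3 := abs_convErr_mul_add hα n
    have h4 : |convErr α (n + 1)| ≤ |convErr α n| := by
      rw [convErr_succ hα, abs_mul, abs_neg, abs_of_pos (gaussOrbit_pos hα _)]
      exact mul_le_of_le_one_left (abs_nonneg _) (gaussOrbit_lt_one α _).le
    rw [div_le_iff₀ (by positivity)]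
    nlinarith [abs_nonneg (convErr α n)]

/-- A `σ`-separated subset of `[0, a)` has at most `⌈a / σ⌉` elements. -/
theorem card_le_of_separated {ι : Type*} (A : Finset ι) (y : ι → ℝ) {a σ : ℝ} (hσ : 0 < σ)
    (hy0 : ∀ i ∈ A, 0 ≤ y i) (hya : ∀ i ∈ A, y i < a)
    (hsep : ∀ i ∈ A, ∀ j ∈ A, i ≠ j → σ ≤ |y i - y j|) :
    A.card ≤ ⌈a / σ⌉₊ := by
  rw [← Finset.card_range ⌈a / σ⌉₊]
  refine Finset.card_le_card_of_injOn (fun i => ⌊y i / σ⌋₊) ?_ ?_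
  · intro i hi
    rw [Finset.mem_coe, Finset.mem_range]
    have h1 : y i / σ < a / σ := by gcongr; exact hya i hi
    have h0 : 0 ≤ y i / σ := div_nonneg (hy0 i hi) hσ.le
    have h2 := (Nat.floor_le h0).trans_lt (h1.trans_le (Nat.le_ceil (a / σ)))
    exact_mod_cast h2
  · intro i hi j hj hij
    by_contra hne
    have h := hsep i hi j hj hne
    have hij' : ⌊y i / σ⌋₊ = ⌊y j / σ⌋₊ := hij
    have hi0 : 0 ≤ y i / σ := div_nonneg (hy0 i hi) hσ.le
    have hj0 : 0 ≤ y j / σ := div_nonneg (hy0 j hj) hσ.le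
    have h1 := Nat.floor_le hi0
    have h2 := Nat.lt_floor_add_one (y i / σ)
    have h3 := Nat.floor_le hj0
    have h4 := Nat.lt_floor_add_one (y j / σ)
    rw [hij'] at h1 h2
    have h5 : |y i / σ - y j / σ| < 1 := by rw [abs_lt]; constructor <;> linarith
    rw [← sub_div, abs_div, abs_of_pos hσ, div_lt_one hσ] at h5
    linarith

/-- Points of an orbit of length `n ≤ 1 / a` visit an arc of length `a` at most `2C + 1` times. -/
theorem card_visits_le {α : ℝ} (hα : Irrational α) (hb : BddAbove (partialQuotients α))
    {a : ℝ} (ha0 : 0 < a) (ha1 : a ≤ 1) {n : ℕ} (hn : n * a ≤ 1) (v : ℝ) :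
    ((((Finset.range n).filter fun i : ℕ => Int.fract (v + i * α) < a).card : ℕ) : ℝ) ≤
      2 * quotientBound α + 1 := by
  obtain ⟨q, hq0, hqa, hqC, hsep⟩ := exists_separation hα hb ha0 ha1
  set A := (Finset.range n).filter fun i : ℕ => Int.fract (v + i * α) < a
  have hnq : (n : ℝ) < q := lt_of_le_of_lt ((le_div_iff₀ ha0).2 hn) hqa
  -- Differences of fractional parts are ±((j - i)α - r) with r an integer, so separation on the
  -- circle passes to the representatives in [0, 1).
  have key : ∀ i ∈ A, ∀ j ∈ A, i < j →
      1 / (2 * q) ≤ |Int.fract (v + i * α) - Int.fract (v + j * α)| := by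
    intro i _ j hj hij
    have hjn : j < n := Finset.mem_range.1 (Finset.mem_filter.1 hj).1
    have h := hsep ((j : ℤ) - i) (by omega) (lt_of_le_of_lt ?_ hnq)
      (⌊v + j * α⌋ - ⌊v + i * α⌋)
    · refine h.trans_eq ?_
      rw [← abs_neg]
      congr 1
      simp only [Int.fract]; push_cast; ring
    · exact_mod_cast (by omega : (j : ℤ) - i ≤ n)
  have hcard := card_le_of_separated A (fun i : ℕ => Int.fract (v + i * α)) (a := a)
    (σ := 1 / (2 * q)) (by positivity) (fun i _ => Int.fract_nonneg _)
    (fun i hi => (Finset.mem_filter.1 hi).2) (fun i hi j hj hij => by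
      rcases lt_or_gt_of_ne hij with h | h
      · exact key i hi j hj h
      · rw [abs_sub_comm]; exact key j hj i hi h)
  have h1 : a / (1 / (2 * q)) ≤ 2 * quotientBound α := by
    rw [div_div_eq_mul_div, div_one]; linarith
  have h2 := two_le_quotientBound hα hb
  calc ((A.card : ℕ) : ℝ) ≤ (⌈a / (1 / (2 * q))⌉₊ : ℝ) := by exact_mod_cast hcard
    _ ≤ a / (1 / (2 * q)) + 1 := (Nat.ceil_lt_add_one (by positivity)).le
    _ ≤ _ := by linarith

/-! ### Absolutely continuous functions on an open interval. -/

theorem AbsolutelyContinuousOnIoo.dist_lt {g : ℝ → ℝ} {a b : ℝ}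
    (hg : AbsolutelyContinuousOnIoo g a b) {ε : ℝ} (hε : 0 < ε) :
    ∃ δ > 0, ∀ x ∈ Ioo a b, ∀ y ∈ Ioo a b, dist x y < δ → dist (g x) (g y) < ε := by
  obtain ⟨δ, hδ, h⟩ := hg ε hε
  refine ⟨δ, hδ, fun x hx y hy hxy => ?_⟩
  have hab : Ioo a b ⊆ uIcc a b := Ioo_subset_Icc_self.trans Icc_subset_uIcc
  have := h (1, fun _ => (x, y)) ?_ ?_ ?_
  · simpa using this
  · refine ⟨fun i _ => ⟨hab hx, hab hy⟩, ?_⟩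
    intro i hi j hj hij
    simp at hi hj
    omega
  · exact fun i _ => ⟨hx, hy⟩
  · simpa using hxy

theorem AbsolutelyContinuousOnIoo.exists_tendsto {g : ℝ → ℝ} {a b : ℝ}
    (hg : AbsolutelyContinuousOnIoo g a b) {c : ℝ} {l : Filter ℝ} [l.NeBot] (hl : l ≤ 𝓝 c)
    (hl' : Ioo a b ∈ l) : ∃ y, Tendsto g l (𝓝 y) := by
  refine cauchy_map_iff_exists_tendsto.1 (Metric.cauchy_iff.2 ⟨inferInstance, fun ε hε => ?_⟩)
  obtain ⟨δ, hδ, h⟩ := hg.dist_lt hε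
  refine ⟨g '' (Ioo a b ∩ Metric.ball c (δ / 2)),
    image_mem_map (inter_mem hl' (hl (Metric.ball_mem_nhds _ (by positivity)))), ?_⟩
  rintro _ ⟨x, ⟨hx, hx'⟩, rfl⟩ _ ⟨y, ⟨hy, hy'⟩, rfl⟩
  refine h x hx y hy ?_
  have := dist_triangle_right x y c
  rw [Metric.mem_ball] at hx' hy'
  linarith

/-- Clamping endpoints shrinks intervals in place, so a disjoint family stays disjoint. -/
theorem uIoc_max_min_subset (a b x y : ℝ) :
    uIoc (max a (min b x)) (max a (min b y)) ⊆ uIoc x y := by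
  intro u hu
  simp only [uIoc, mem_Ioc, inf_lt_iff, le_sup_iff, sup_lt_iff, le_inf_iff] at *
  grind

/-- An absolutely continuous function on `(a, b)` extends to an absolutely continuous function on
`[a, b]`. -/
theorem AbsolutelyContinuousOnIoo.exists_extension {g : ℝ → ℝ} {a b : ℝ} (hab : a < b)
    (hg : AbsolutelyContinuousOnIoo g a b) :
    ∃ G : ℝ → ℝ, AbsolutelyContinuousOnInterval G a b ∧ EqOn G g (Ioo a b) := by
  have hlim : ∀ x ∈ Icc a b, ∃ y, Tendsto g (𝓝[Ioo a b] x) (𝓝 y) := by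
    intro x hx
    have : (𝓝[Ioo a b] x).NeBot := by
      rw [← mem_closure_iff_nhdsWithin_neBot, closure_Ioo hab.ne]; exact hx
    exact hg.exists_tendsto nhdsWithin_le_nhds self_mem_nhdsWithin
  have hcont : ContinuousOn g (Ioo a b) := by
    intro x hx
    obtain ⟨y, hy⟩ := hlim x (Ioo_subset_Icc_self hx)
    have : g x = y := by
      have h1 : pure x ≤ 𝓝[Ioo a b] x := pure_le_nhdsWithin hx
      have h2 := hy.mono_left h1
      rw [tendsto_pure_left] at h2
      by_contra hne
      obtain ⟨U, V, hU, hV, hgU, hyV, hUV⟩ := t2_separation hne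
      exact disjoint_left.1 hUV hgU (h2 V (hV.mem_nhds hyV))
    rw [ContinuousWithinAt, this]; exact hy
  have hG : ContinuousOn (extendFrom (Ioo a b) g) (Icc a b) :=
    continuousOn_extendFrom (closure_Ioo hab.ne).ge hlim
  have hGg : EqOn (extendFrom (Ioo a b) g) g (Ioo a b) := fun x hx =>
    extendFrom_eq (subset_closure hx) (hcont x hx)
  refine ⟨extendFrom (Ioo a b) g, ?_, hGg⟩
  set G := extendFrom (Ioo a b) g
  rw [absolutelyContinuousOnInterval_iff]
  intro ε hε
  obtain ⟨δ, hδ, h⟩ := hg (ε / 2) (half_pos hε)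
  refine ⟨δ, hδ, fun E hE hlen => ?_⟩
  -- Clamping by τ moves all endpoints into the open interval, where the hypothesis applies; then τ
  -- → 0. The limit keeps only a weak inequality, hence the ε / 2 above.
  let φ : ℝ → ℝ → ℝ := fun τ x => max (a + τ) (min (b - τ) x)
  have hφ : ∀ x ∈ Icc a b, Tendsto (fun τ => G (φ τ x)) (𝓝[>] 0) (𝓝 (G x)) := by
    intro x hx
    have h1 : Tendsto (fun τ => φ τ x) (𝓝[>] 0) (𝓝[Icc a b] x) := by
      refine tendsto_nhdsWithin_iff.2 ⟨?_, ?_⟩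
      · have hc : Continuous fun τ => φ τ x := by fun_prop
        have := hc.tendsto 0
        have e : φ 0 x = x := by simp [φ, hx.1, hx.2]
        rw [e] at this
        exact this.mono_left nhdsWithin_le_nhds
      · have : Ioo 0 (b - a) ∈ 𝓝[>] (0 : ℝ) := Ioo_mem_nhdsGT (by linarith)
        filter_upwards [this] with τ hτ
        exact ⟨le_max_of_le_left (by linarith [hτ.1]),
          max_le (by linarith [hτ.2]) (min_le_of_left_le (by linarith [hτ.1]))⟩
    exact (hG x hx).tendsto.comp h1
  have hsum : Tendsto (fun τ => ∑ i ∈ Finset.range E.1,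
      dist (G (φ τ (E.2 i).1)) (G (φ τ (E.2 i).2))) (𝓝[>] 0)
      (𝓝 (∑ i ∈ Finset.range E.1, dist (G (E.2 i).1) (G (E.2 i).2))) := by
    refine tendsto_finsetSum _ fun i hi => ?_
    have := hE.1 i hi
    rw [uIcc_of_le hab.le] at this
    exact (hφ _ this.1).dist (hφ _ this.2)
  refine lt_of_le_of_lt (le_of_tendsto hsum ?_) (half_lt_self hε)
  have hev : Ioo 0 ((b - a) / 2) ∈ 𝓝[>] (0 : ℝ) := Ioo_mem_nhdsGT (by linarith)
  filter_upwards [hev] with τ hτ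
  have hmem : ∀ x, φ τ x ∈ Ioo a b := fun x =>
    ⟨lt_max_of_lt_left (by linarith [hτ.1]),
      max_lt (by linarith [hτ.2]) (min_lt_of_left_lt (by linarith [hτ.1]))⟩
  have hsub : Ioo a b ⊆ uIcc a b := Ioo_subset_Icc_self.trans Icc_subset_uIcc
  have := h (E.1, fun i => (φ τ (E.2 i).1, φ τ (E.2 i).2))
    ⟨fun i _ => ⟨hsub (hmem _), hsub (hmem _)⟩, fun i hi j hj hij =>
      (hE.2 hi hj hij).mono (uIoc_max_min_subset _ _ _ _) (uIoc_max_min_subset _ _ _ _)⟩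
    (fun i _ => ⟨hmem _, hmem _⟩) ?_
  · refine le_trans (Finset.sum_le_sum fun i _ => ?_) this.le
    rw [hGg (hmem _), hGg (hmem _)]
  · refine lt_of_le_of_lt (Finset.sum_le_sum fun i _ => ?_) hlen
    simp only [Real.dist_eq, φ]
    have h1 := abs_max_sub_max_le_max (a + τ) (min (b - τ) (E.2 i).1) (a + τ)
      (min (b - τ) (E.2 i).2)
    have h2 := abs_min_sub_min_le_max (b - τ) (E.2 i).1 (b - τ) (E.2 i).2
    simp only [sub_self, abs_zero] at h1 h2
    exact h1.trans (max_le (abs_nonneg _) (h2.trans (max_le (abs_nonneg _) le_rfl)))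

/-- The integrand is the derivative of `g` itself, which agrees with that of the extension off the
endpoints. Only the values at the endpoints require `G`. -/
theorem AbsolutelyContinuousOnIoo.exists_primitive {g : ℝ → ℝ} {a b : ℝ} (hab : a < b)
    (hg : AbsolutelyContinuousOnIoo g a b) :
    ∃ G : ℝ → ℝ, ContinuousOn G (Icc a b) ∧ EqOn G g (Ioo a b) ∧
      IntervalIntegrable (deriv g) volume a b ∧
      ∀ x ∈ Icc a b, ∀ y ∈ Icc a b, ∫ u in x..y, deriv g u = G y - G x := by
  obtain ⟨G, hG, hGg⟩ := hg.exists_extension hab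
  have hd : ∀ u ∈ Ioo a b, deriv G u = deriv g u := fun u hu =>
    Filter.EventuallyEq.deriv_eq (hGg.eventuallyEq_of_mem (Ioo_mem_nhds hu.1 hu.2))
  have hae : ∀ᵐ u : ℝ, u ∈ Icc a b → deriv G u = deriv g u := by
    have h1 : ∀ᵐ u : ℝ, u ≠ a := ae_iff.2 (by simp)
    have h2 : ∀ᵐ u : ℝ, u ≠ b := ae_iff.2 (by simp)
    filter_upwards [h1, h2] with u hu1 hu2 hu
    exact hd u ⟨lt_of_le_of_ne hu.1 hu1.symm, lt_of_le_of_ne hu.2 hu2⟩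
  refine ⟨G, by simpa [uIcc_of_le hab.le] using hG.continuousOn, hGg, ?_, ?_⟩
  · refine hG.intervalIntegrable_deriv.congr_ae ?_
    rw [Filter.EventuallyEq, ae_restrict_iff' measurableSet_uIoc]
    filter_upwards [hae] with u hu hu'
    rw [uIoc_of_le hab.le] at hu'
    exact hu ⟨hu'.1.le, hu'.2⟩
  · intro x hx y hy
    have hsub : uIcc x y ⊆ uIcc a b := by
      rw [uIcc_of_le hab.le]; exact uIcc_subset_Icc hx hy
    rw [← (hG.mono hsub).integral_deriv_eq_sub]
    refine intervalIntegral.integral_congr_ae ?_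
    filter_upwards [hae] with u hu hu'
    have := hsub (uIoc_subset_uIcc hu')
    rw [uIcc_of_le hab.le] at this
    exact (hu this).symm

/-! ### Decomposition of `f` into an integral and a step function. -/

/-- The lift of a function on the circle to a periodic function on the line. -/
def periodicLift (f : UnitAddCircle → ℝ) (t : ℝ) : ℝ := f (t : UnitAddCircle)

theorem periodicLift_add_intCast (f : UnitAddCircle → ℝ) (t : ℝ) (m : ℤ) :
    periodicLift f (t + m) = periodicLift f t := by
  unfold periodicLift
  congr 1
  have : ((m : ℝ) : UnitAddCircle) = 0 :=
    (AddCircle.coe_eq_zero_iff (1 : ℝ)).2 ⟨m, by simp⟩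
  rw [AddCircle.coe_add, this, add_zero]

theorem periodicLift_sub_intCast (f : UnitAddCircle → ℝ) (t : ℝ) (m : ℤ) :
    periodicLift f (t - m) = periodicLift f t := by
  rw [← periodicLift_add_intCast f (t - m) m, sub_add_cancel]

theorem deriv_periodicLift_add_intCast (f : UnitAddCircle → ℝ) (t : ℝ) (m : ℤ) :
    deriv (periodicLift f) (t + m) = deriv (periodicLift f) t := by
  rw [← deriv_comp_add_const]
  congr 1
  ext s
  exact periodicLift_add_intCast f s m

theorem deriv_periodicLift_sub_intCast (f : UnitAddCircle → ℝ) (t : ℝ) (m : ℤ) :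
    deriv (periodicLift f) (t - m) = deriv (periodicLift f) t := by
  rw [← deriv_periodicLift_add_intCast f (t - m) m, sub_add_cancel]

theorem periodic_deriv_periodicLift (f : UnitAddCircle → ℝ) :
    Function.Periodic (deriv (periodicLift f)) 1 := fun t => by
  simpa using deriv_periodicLift_add_intCast f t 1

/-- The preimage in `ℝ` of the set of discontinuities. -/
def singularSet {k : ℕ} (β : Fin (k + 1) → ℝ) : Set ℝ :=
  {t | ∃ (j : Fin k) (m : ℤ), t = β j.castSucc + m}

theorem add_intCast_mem_singularSet {k : ℕ} {β : Fin (k + 1) → ℝ} {t : ℝ} {m : ℤ} :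
    t + m ∈ singularSet β ↔ t ∈ singularSet β := by
  constructor
  · rintro ⟨j, l, h⟩
    exact ⟨j, l - m, by push_cast; linarith⟩
  · rintro ⟨j, l, h⟩
    exact ⟨j, l + m, by push_cast; linarith⟩

theorem countable_singularSet {k : ℕ} (β : Fin (k + 1) → ℝ) : (singularSet β).Countable := by
  have : singularSet β = ⋃ j : Fin k, range fun m : ℤ => β j.castSucc + m := by
    ext t; simp [singularSet, eq_comm]
  rw [this]
  exact countable_iUnion fun j => countable_range _

theorem exists_castSucc_le_lt_succ {k : ℕ} (β : Fin (k + 1) → ℝ) {t : ℝ} (h0 : β 0 ≤ t)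
    (h1 : t < β (Fin.last k)) : ∃ j : Fin k, β j.castSucc ≤ t ∧ t < β j.succ := by
  by_contra! h
  have : ∀ i : Fin (k + 1), β i ≤ t := fun i => Fin.induction h0 (fun j hj => h j hj) i
  exact (this (Fin.last k)).not_gt h1

theorem exists_castSucc_lt_le_succ {k : ℕ} (β : Fin (k + 1) → ℝ) {t : ℝ} (h0 : β 0 < t)
    (h1 : t ≤ β (Fin.last k)) : ∃ j : Fin k, β j.castSucc < t ∧ t ≤ β j.succ := by
  by_contra! h
  have : ∀ i : Fin (k + 1), β i < t := fun i => Fin.induction h0 (fun j hj => h j hj) i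
  exact (this (Fin.last k)).not_ge h1

namespace IsPiecewiseAbsolutelyContinuous

variable {f : UnitAddCircle → ℝ} {k : ℕ} {β : Fin (k + 1) → ℝ}

theorem castSucc_lt_succ (hβ : IsPiecewiseAbsolutelyContinuous f β) (j : Fin k) :
    β j.castSucc < β j.succ := hβ.strictMono j.castSucc_lt_succ

theorem intervalIntegrable_deriv (hβ : IsPiecewiseAbsolutelyContinuous f β) (a b : ℝ) :
    IntervalIntegrable (deriv (periodicLift f)) volume a b := by
  have h : ∀ i : Fin (k + 1), IntervalIntegrable (deriv (periodicLift f)) volume (β 0) (β i) := by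
    intro i
    induction i using Fin.induction with
    | zero => exact IntervalIntegrable.refl
    | succ j ih =>
      obtain ⟨G, -, -, hint, -⟩ :=
        (hβ.absolutelyContinuous j).exists_primitive (hβ.castSucc_lt_succ j)
      exact ih.trans hint
  have h1 := h (Fin.last k)
  rw [hβ.last_eq] at h1
  exact (periodic_deriv_periodicLift f).intervalIntegrable one_ne_zero h1 a b

theorem exists_primitive (hβ : IsPiecewiseAbsolutelyContinuous f β) (j : Fin k) (m : ℤ) :
    ∃ G : ℝ → ℝ, ContinuousOn G (Icc (β j.castSucc + m) (β j.succ + m)) ∧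
      EqOn G (periodicLift f) (Ioo (β j.castSucc + m) (β j.succ + m)) ∧
      ∀ x ∈ Icc (β j.castSucc + m) (β j.succ + m), ∀ y ∈ Icc (β j.castSucc + m) (β j.succ + m),
        ∫ u in x..y, deriv (periodicLift f) u = G y - G x := by
  obtain ⟨G, hG, hGf, -, hint⟩ :=
    (hβ.absolutelyContinuous j).exists_primitive (hβ.castSucc_lt_succ j)
  have hmem : ∀ x ∈ Icc (β j.castSucc + m) (β j.succ + m),
      x - m ∈ Icc (β j.castSucc) (β j.succ) := fun x hx =>
    ⟨by linarith [hx.1], by linarith [hx.2]⟩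
  refine ⟨fun x => G (x - m), hG.comp (by fun_prop) hmem, ?_, ?_⟩
  · intro x hx
    have : x - m ∈ Ioo (β j.castSucc) (β j.succ) := ⟨by linarith [hx.1], by linarith [hx.2]⟩
    refine (hGf this).trans ?_
    exact periodicLift_sub_intCast f x m
  · intro x hx y hy
    rw [← hint _ (hmem x hx) _ (hmem y hy), ← intervalIntegral.integral_comp_sub_right]
    congr 1
    ext u
    exact (deriv_periodicLift_sub_intCast f u m).symm

theorem notMem_singularSet (hβ : IsPiecewiseAbsolutelyContinuous f β) {j : Fin k} {m : ℤ} {s : ℝ}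
    (hs : s ∈ Ioo (β j.castSucc + m) (β j.succ + m)) : s ∉ singularSet β := by
  rintro ⟨i, l, rfl⟩
  have hi0 : β 0 ≤ β i.castSucc := hβ.strictMono.monotone (Fin.zero_le _)
  have hi1 : β i.castSucc < β 0 + 1 := by
    rw [← hβ.last_eq]; exact hβ.strictMono (Fin.castSucc_lt_last i)
  have hj0 : β 0 ≤ β j.castSucc := hβ.strictMono.monotone (Fin.zero_le _)
  have hj1 : β j.succ ≤ β 0 + 1 := by
    rw [← hβ.last_eq]; exact hβ.strictMono.monotone (Fin.le_last _)
  obtain ⟨h1, h2⟩ := hs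
  have hlm : l = m := by
    have a1 : (l : ℝ) < m + 1 := by linarith
    have a2 : (m : ℝ) < l + 1 := by linarith
    norm_cast at a1 a2
    omega
  subst hlm
  have h1' : j.castSucc < i.castSucc := hβ.strictMono.lt_iff_lt.1 (by linarith)
  have h2' : i.castSucc < j.succ := hβ.strictMono.lt_iff_lt.1 (by linarith)
  simp only [Fin.lt_def, Fin.val_castSucc, Fin.val_succ] at h1' h2'
  omega

theorem exists_arc_right (hβ : IsPiecewiseAbsolutelyContinuous f β) (t : ℝ) :
    ∃ (j : Fin k) (m : ℤ), β j.castSucc + m ≤ t ∧ t < β j.succ + m := by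
  have h0 := Int.floor_le (t - β 0)
  have h1 := Int.lt_floor_add_one (t - β 0)
  obtain ⟨j, hj1, hj2⟩ := exists_castSucc_le_lt_succ β (t := t - ⌊t - β 0⌋) (by linarith)
    (by rw [hβ.last_eq]; linarith)
  exact ⟨j, ⌊t - β 0⌋, by linarith, by linarith⟩

theorem exists_arc_left (hβ : IsPiecewiseAbsolutelyContinuous f β) (t : ℝ) :
    ∃ (j : Fin k) (m : ℤ), β j.castSucc + m < t ∧ t ≤ β j.succ + m := by
  have h0 := Int.le_ceil (t - β 0)
  have h1 := Int.ceil_lt_add_one (t - β 0)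
  obtain ⟨j, hj1, hj2⟩ := exists_castSucc_lt_le_succ β (t := t - (⌈t - β 0⌉ - 1 : ℤ))
    (by push_cast; linarith) (by rw [hβ.last_eq]; push_cast; linarith)
  exact ⟨j, ⌈t - β 0⌉ - 1, by linarith, by linarith⟩

theorem tendsto_rightLim (hβ : IsPiecewiseAbsolutelyContinuous f β) (t : ℝ) :
    Tendsto (periodicLift f) (𝓝[>] t) (𝓝 (Function.rightLim (periodicLift f) t)) := by
  obtain ⟨j, m, h1, h2⟩ := hβ.exists_arc_right t
  obtain ⟨G, hG, hGf, -⟩ := hβ.exists_primitive j m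
  have hT : Tendsto (periodicLift f) (𝓝[>] t) (𝓝 (G t)) := by
    have hle : 𝓝[>] t ≤ 𝓝[Icc (β j.castSucc + m) (β j.succ + m)] t := by
      rw [← nhdsWithin_Ioo_eq_nhdsGT h2]
      exact nhdsWithin_mono _ fun x hx => ⟨h1.trans hx.1.le, hx.2.le⟩
    refine ((hG t ⟨h1, h2.le⟩).tendsto.mono_left hle).congr' ?_
    filter_upwards [Ioo_mem_nhdsGT h2] with x hx
    exact hGf ⟨h1.trans_lt hx.1, hx.2⟩
  rwa [rightLim_eq_of_tendsto hT]

theorem tendsto_leftLim (hβ : IsPiecewiseAbsolutelyContinuous f β) (t : ℝ) :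
    Tendsto (periodicLift f) (𝓝[<] t) (𝓝 (Function.leftLim (periodicLift f) t)) := by
  obtain ⟨j, m, h1, h2⟩ := hβ.exists_arc_left t
  obtain ⟨G, hG, hGf, -⟩ := hβ.exists_primitive j m
  have hT : Tendsto (periodicLift f) (𝓝[<] t) (𝓝 (G t)) := by
    have hle : 𝓝[<] t ≤ 𝓝[Icc (β j.castSucc + m) (β j.succ + m)] t := by
      rw [← nhdsWithin_Ioo_eq_nhdsLT h1]
      exact nhdsWithin_mono _ fun x hx => ⟨hx.1.le, hx.2.le.trans h2⟩
    refine ((hG t ⟨h1.le, h2⟩).tendsto.mono_left hle).congr' ?_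
    filter_upwards [Ioo_mem_nhdsLT h1] with x hx
    exact hGf ⟨hx.1, hx.2.trans_le h2⟩
  rwa [leftLim_eq_of_tendsto hT]

theorem mem_Ioo_of_notMem_singularSet (hβ : IsPiecewiseAbsolutelyContinuous f β) {t : ℝ}
    (ht : t ∉ singularSet β) :
    ∃ (j : Fin k) (m : ℤ), t ∈ Ioo (β j.castSucc + m) (β j.succ + m) := by
  obtain ⟨j, m, h1, h2⟩ := hβ.exists_arc_right t
  exact ⟨j, m, lt_of_le_of_ne h1 fun h => ht ⟨j, m, h.symm⟩, h2⟩

theorem continuousAt_of_notMem (hβ : IsPiecewiseAbsolutelyContinuous f β) {t : ℝ}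
    (ht : t ∉ singularSet β) : ContinuousAt (periodicLift f) t := by
  obtain ⟨j, m, h⟩ := hβ.mem_Ioo_of_notMem_singularSet ht
  obtain ⟨G, hG, hGf, -⟩ := hβ.exists_primitive j m
  exact (hG.continuousAt (Icc_mem_nhds h.1 h.2)).congr
    (hGf.eventuallyEq_of_mem (Ioo_mem_nhds h.1 h.2))

theorem jump_add_intCast (hβ : IsPiecewiseAbsolutelyContinuous f β) (t : ℝ) (m : ℤ) :
    jump f (t + m) = jump f t := by
  have hcont : ContinuousAt (fun s : ℝ => s - m) (t + m) := by fun_prop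
  have hl : Function.leftLim (periodicLift f) (t + m) = Function.leftLim (periodicLift f) t := by
    refine leftLim_eq_of_tendsto ?_
    have h : Tendsto (fun s : ℝ => s - m) (𝓝[<] (t + m)) (𝓝[<] t) := by
      refine tendsto_nhdsWithin_iff.2 ⟨?_, ?_⟩
      · have := hcont.tendsto.mono_left (nhdsWithin_le_nhds (s := Iio (t + m)))
        simpa using this
      · filter_upwards [self_mem_nhdsWithin] with s hs
        rw [mem_Iio] at *; linarith
    exact ((hβ.tendsto_leftLim t).comp h).congr fun s => periodicLift_sub_intCast f s m
  have hr : Function.rightLim (periodicLift f) (t + m) = Function.rightLim (periodicLift f) t := by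
    refine rightLim_eq_of_tendsto ?_
    have h : Tendsto (fun s : ℝ => s - m) (𝓝[>] (t + m)) (𝓝[>] t) := by
      refine tendsto_nhdsWithin_iff.2 ⟨?_, ?_⟩
      · have := hcont.tendsto.mono_left (nhdsWithin_le_nhds (s := Ioi (t + m)))
        simpa using this
      · filter_upwards [self_mem_nhdsWithin] with s hs
        rw [mem_Ioi] at *; linarith
    exact ((hβ.tendsto_rightLim t).comp h).congr fun s => periodicLift_sub_intCast f s m
  change Function.leftLim (periodicLift f) (t + m) - Function.rightLim (periodicLift f) (t + m) =
    Function.leftLim (periodicLift f) t - Function.rightLim (periodicLift f) t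
  rw [hl, hr]

/-- The factor `⌊s⌋ + 1 - ⌈s⌉` is the indicator of the integers, so at most one term survives. In
this form the jump matches the difference of the one-sided limits of the floors. -/
theorem jump_eq_sum (hβ : IsPiecewiseAbsolutelyContinuous f β) (t : ℝ) :
    jump f t = ∑ j : Fin k, jump f (β j.castSucc) *
      (⌊t - β j.castSucc⌋ + 1 - ⌈t - β j.castSucc⌉) := by
  have hnon : ∀ j : Fin k, (∀ m : ℤ, t ≠ β j.castSucc + m) →
      ((⌊t - β j.castSucc⌋ : ℝ) + 1 - ⌈t - β j.castSucc⌉) = 0 := by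
    intro j hj
    have : ⌈t - β j.castSucc⌉ = ⌊t - β j.castSucc⌋ + 1 := by
      rw [Int.ceil_eq_floor_add_one_iff_notMem]
      rintro ⟨m, hm⟩
      exact hj m (by rw [hm]; ring)
    rw [this]; push_cast; ring
  by_cases ht : t ∈ singularSet β
  · obtain ⟨i, m, rfl⟩ := ht
    rw [hβ.jump_add_intCast, Finset.sum_eq_single i]
    · simp
    · intro j _ hji
      rw [hnon j, mul_zero]
      intro l hl
      have hi0 : β 0 ≤ β i.castSucc := hβ.strictMono.monotone (Fin.zero_le _)
      have hi1 : β i.castSucc < β 0 + 1 := by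
        rw [← hβ.last_eq]; exact hβ.strictMono (Fin.castSucc_lt_last i)
      have hj0 : β 0 ≤ β j.castSucc := hβ.strictMono.monotone (Fin.zero_le _)
      have hj1 : β j.castSucc < β 0 + 1 := by
        rw [← hβ.last_eq]; exact hβ.strictMono (Fin.castSucc_lt_last j)
      have hlm : l = m := by
        have a1 : (l : ℝ) < m + 1 := by linarith
        have a2 : (m : ℝ) < l + 1 := by linarith
        norm_cast at a1 a2
        omega
      subst hlm
      exact hji (Fin.castSucc_injective k (hβ.strictMono.injective (by linarith)))
    · simp
  · have hc := hβ.continuousAt_of_notMem ht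
    have hl : Function.leftLim (periodicLift f) t = periodicLift f t :=
      hc.continuousWithinAt.leftLim_eq
    have hr : Function.rightLim (periodicLift f) t = periodicLift f t :=
      hc.continuousWithinAt.rightLim_eq
    change Function.leftLim (periodicLift f) t - Function.rightLim (periodicLift f) t = _
    rw [hl, hr, sub_self, eq_comm]
    refine Finset.sum_eq_zero fun j _ => ?_
    rw [hnon j (fun m hm => ht ⟨j, m, hm⟩), mul_zero]

theorem floor_sub_eq (hβ : IsPiecewiseAbsolutelyContinuous f β) {j : Fin k} {m : ℤ} {s s' : ℝ}
    (hs : s ∈ Ioo (β j.castSucc + m) (β j.succ + m))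
    (hs' : s' ∈ Ioo (β j.castSucc + m) (β j.succ + m)) (i : Fin k) :
    ⌊s - β i.castSucc⌋ = ⌊s' - β i.castSucc⌋ := by
  wlog hle : s ≤ s' generalizing s s'
  · exact (this hs' hs (le_of_not_ge hle)).symm
  refine le_antisymm (Int.floor_mono (by linarith)) ?_
  by_contra! hlt
  have h1 := Int.floor_lt.1 hlt
  have h2 := Int.floor_le (s' - β i.castSucc)
  exact hβ.notMem_singularSet (j := j) (m := m) (s := β i.castSucc + ⌊s' - β i.castSucc⌋)
    ⟨by linarith [hs.1], by linarith [hs'.2]⟩ ⟨i, _, rfl⟩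

/-- The lift of `f` minus its absolutely continuous and its pure jump part. -/
def remainder (f : UnitAddCircle → ℝ) {k : ℕ} (β : Fin (k + 1) → ℝ) (t : ℝ) : ℝ :=
  periodicLift f t - (∫ u in (0 : ℝ)..t, deriv (periodicLift f) u) +
    ∑ j : Fin k, jump f (β j.castSucc) * ⌊t - β j.castSucc⌋

theorem remainder_eq_of_mem (hβ : IsPiecewiseAbsolutelyContinuous f β) {j : Fin k} {m : ℤ}
    {s s' : ℝ} (hs : s ∈ Ioo (β j.castSucc + m) (β j.succ + m))
    (hs' : s' ∈ Ioo (β j.castSucc + m) (β j.succ + m)) :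
    remainder f β s = remainder f β s' := by
  obtain ⟨G, -, hGf, hint⟩ := hβ.exists_primitive j m
  have h1 := hint s (Ioo_subset_Icc_self hs) s' (Ioo_subset_Icc_self hs')
  rw [hGf hs, hGf hs', ← intervalIntegral.integral_interval_sub_left
    (hβ.intervalIntegrable_deriv 0 s') (hβ.intervalIntegrable_deriv 0 s)] at h1
  unfold remainder
  simp_rw [hβ.floor_sub_eq hs hs']
  linarith

theorem continuous_integral_deriv (hβ : IsPiecewiseAbsolutelyContinuous f β) :
    Continuous fun t : ℝ => ∫ u in (0 : ℝ)..t, deriv (periodicLift f) u :=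
  intervalIntegral.continuous_primitive hβ.intervalIntegrable_deriv 0

/-- Across t the weighted sum of floors gains exactly the jump that the lift of `f` loses, and the
integral is continuous. -/
theorem tendsto_remainder (hβ : IsPiecewiseAbsolutelyContinuous f β) (t : ℝ) :
    ∃ c, Tendsto (remainder f β) (𝓝[>] t) (𝓝 c) ∧ Tendsto (remainder f β) (𝓝[<] t) (𝓝 c) := by
  have hI : Tendsto (fun t : ℝ => ∫ u in (0 : ℝ)..t, deriv (periodicLift f) u) (𝓝 t) (𝓝 _) :=
    hβ.continuous_integral_deriv.tendsto t
  have hsub : ∀ b : ℝ, Tendsto (fun s : ℝ => s - b) (𝓝[>] t) (𝓝[>] (t - b)) := fun b => by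
    refine tendsto_nhdsWithin_iff.2 ⟨?_, ?_⟩
    · have : ContinuousAt (fun s : ℝ => s - b) t := by fun_prop
      exact this.tendsto.mono_left nhdsWithin_le_nhds
    · filter_upwards [self_mem_nhdsWithin] with s hs
      rw [mem_Ioi] at *; linarith
  have hsub' : ∀ b : ℝ, Tendsto (fun s : ℝ => s - b) (𝓝[<] t) (𝓝[<] (t - b)) := fun b => by
    refine tendsto_nhdsWithin_iff.2 ⟨?_, ?_⟩
    · have : ContinuousAt (fun s : ℝ => s - b) t := by fun_prop
      exact this.tendsto.mono_left nhdsWithin_le_nhds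
    · filter_upwards [self_mem_nhdsWithin] with s hs
      rw [mem_Iio] at *; linarith
  have hcast : ∀ z : ℤ, Tendsto (fun n : ℤ => (n : ℝ)) (pure z) (𝓝 (z : ℝ)) := fun z =>
    (tendsto_pure_pure _ _).mono_right (pure_le_nhds _)
  have hr := ((hβ.tendsto_rightLim t).sub (hI.mono_left nhdsWithin_le_nhds)).add
    (tendsto_finsetSum Finset.univ fun (j : Fin k) _ => (((hcast _).comp
      ((tendsto_floor_right_pure_floor (t - β j.castSucc)).comp
        ((hsub (β j.castSucc)).mono_right (nhdsWithin_mono _ Ioi_subset_Ici_self)))).const_mul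
          (jump f (β j.castSucc))))
  have hl := ((hβ.tendsto_leftLim t).sub (hI.mono_left nhdsWithin_le_nhds)).add
    (tendsto_finsetSum Finset.univ fun (j : Fin k) _ => (((hcast _).comp
      ((tendsto_floor_left_pure_ceil_sub_one (t - β j.castSucc)).comp
        (hsub' (β j.castSucc)))).const_mul (jump f (β j.castSucc))))
  refine ⟨_, hr, ?_⟩
  convert! hl using 2
  have hj : Function.leftLim (periodicLift f) t - Function.rightLim (periodicLift f) t = _ :=
    hβ.jump_eq_sum t
  have e : ∑ j : Fin k, jump f (β j.castSucc) *
      ((⌊t - β j.castSucc⌋ : ℝ) + 1 - ⌈t - β j.castSucc⌉) =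
      ∑ j : Fin k, jump f (β j.castSucc) * (⌊t - β j.castSucc⌋ : ℝ) -
      ∑ j : Fin k, jump f (β j.castSucc) * (((⌈t - β j.castSucc⌉ - 1 : ℤ)) : ℝ) := by
    rw [← Finset.sum_sub_distrib]
    refine Finset.sum_congr rfl fun j _ => ?_
    push_cast; ring
  rw [e] at hj
  linarith

/-- The remainder is constant off the singular set. -/
theorem exists_remainder_eq (hβ : IsPiecewiseAbsolutelyContinuous f β) :
    ∃ c, ∀ t ∉ singularSet β, remainder f β t = c := by
  choose c hcr hcl using hβ.tendsto_remainder
  have hev : ∀ t, ∀ᶠ s in 𝓝[≠] t, remainder f β s = c t ∧ s ∉ singularSet β := by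
    intro t
    rw [← Iio_union_Ioi, nhdsWithin_union, eventually_sup]
    constructor
    · obtain ⟨j, m, h1, h2⟩ := hβ.exists_arc_left t
      have hmem : Ioo (β j.castSucc + m) t ∈ 𝓝[<] t := Ioo_mem_nhdsLT h1
      filter_upwards [hmem] with s hs
      have hs' : s ∈ Ioo (β j.castSucc + m) (β j.succ + m) := ⟨hs.1, hs.2.trans_le h2⟩
      refine ⟨tendsto_nhds_unique (Tendsto.congr' ?_ tendsto_const_nhds) (hcl t),
        hβ.notMem_singularSet hs'⟩
      filter_upwards [hmem] with u hu
      exact hβ.remainder_eq_of_mem hs' ⟨hu.1, hu.2.trans_le h2⟩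
    · obtain ⟨j, m, h1, h2⟩ := hβ.exists_arc_right t
      have hmem : Ioo t (β j.succ + m) ∈ 𝓝[>] t := Ioo_mem_nhdsGT h2
      filter_upwards [hmem] with s hs
      have hs' : s ∈ Ioo (β j.castSucc + m) (β j.succ + m) := ⟨h1.trans_lt hs.1, hs.2⟩
      refine ⟨tendsto_nhds_unique (Tendsto.congr' ?_ tendsto_const_nhds) (hcr t),
        hβ.notMem_singularSet hs'⟩
      filter_upwards [hmem] with u hu
      exact hβ.remainder_eq_of_mem hs' ⟨h1.trans_lt hu.1, hu.2⟩
  have hoff : ∀ t ∉ singularSet β, remainder f β t = c t := by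
    intro t ht
    obtain ⟨j, m, h⟩ := hβ.mem_Ioo_of_notMem_singularSet ht
    refine tendsto_nhds_unique (Tendsto.congr' ?_ tendsto_const_nhds) (hcr t)
    filter_upwards [Ioo_mem_nhdsGT h.2] with s hs
    exact hβ.remainder_eq_of_mem h ⟨h.1.trans hs.1, hs.2⟩
  -- The common one-sided limit `c` is locally constant, and connectedness of ℝ makes it constant.
  have hloc : IsLocallyConstant c := by
    rw [IsLocallyConstant.iff_eventually_eq]
    intro t
    have := hev t
    rw [eventually_nhdsWithin_iff] at this
    filter_upwards [this] with s hs
    by_cases hst : s = t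
    · rw [hst]
    · rw [← hoff s (hs hst).2, (hs hst).1]
  obtain ⟨c0, hc0⟩ := hloc.exists_eq_const
  exact ⟨c0, fun t ht => by rw [hoff t ht, hc0]; rfl⟩

theorem exists_notMem_singularSet (hβ : IsPiecewiseAbsolutelyContinuous f β) :
    ∃ t, t ∉ singularSet β := by
  obtain ⟨j, m, h1, h2⟩ := hβ.exists_arc_right 0
  exact ⟨_, hβ.notMem_singularSet ⟨h1.trans_lt (left_lt_add_div_two.2 h2),
    add_div_two_lt_right.2 h2⟩⟩

/-- The constant remainder cancels. Both endpoints must avoid the singular set, where the value of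
`f` is arbitrary. -/
theorem sub_eq_integral (hβ : IsPiecewiseAbsolutelyContinuous f β) {x y : ℝ}
    (hx : x ∉ singularSet β) (hy : y ∉ singularSet β) :
    periodicLift f y - periodicLift f x = (∫ u in x..y, deriv (periodicLift f) u) -
      ∑ j : Fin k, jump f (β j.castSucc) *
        ((⌊y - β j.castSucc⌋ : ℝ) - ⌊x - β j.castSucc⌋) := by
  obtain ⟨c, hc⟩ := hβ.exists_remainder_eq
  have h1 := hc x hx
  have h2 := hc y hy
  unfold remainder at h1 h2
  rw [← intervalIntegral.integral_interval_sub_left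
    (hβ.intervalIntegrable_deriv 0 y) (hβ.intervalIntegrable_deriv 0 x)]
  simp_rw [mul_sub]
  rw [Finset.sum_sub_distrib]
  linarith

/-- Over one period `f` returns to its value while each floor grows by one, so the integral
compensates all the jumps. -/
theorem integral_deriv_eq_sumOfJumps (hβ : IsPiecewiseAbsolutelyContinuous f β) :
    ∫ u in (0 : ℝ)..1, deriv (periodicLift f) u = sumOfJumps f β := by
  obtain ⟨t, ht⟩ := hβ.exists_notMem_singularSet
  have ht' : t + 1 ∉ singularSet β := by
    have := (add_intCast_mem_singularSet (β := β) (t := t) (m := 1)).not.2 ht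
    simpa using this
  have h := hβ.sub_eq_integral ht ht'
  have hp : periodicLift f (t + 1) = periodicLift f t := by
    simpa using periodicLift_add_intCast f t 1
  have h2 := (periodic_deriv_periodicLift f).intervalIntegral_add_eq t 0
  rw [zero_add] at h2
  have e : ∀ j : Fin k, ((⌊t + 1 - β j.castSucc⌋ : ℝ) - ⌊t - β j.castSucc⌋) = 1 := by
    intro j
    rw [show t + 1 - β j.castSucc = t - β j.castSucc + 1 by ring, Int.floor_add_one]
    push_cast; ring
  simp_rw [e, mul_one] at h
  rw [hp, h2, sub_self] at h
  unfold sumOfJumps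
  linarith

theorem measurable_periodicLift (hβ : IsPiecewiseAbsolutelyContinuous f β) :
    Measurable (periodicLift f) := by
  obtain ⟨c, hc⟩ := hβ.exists_remainder_eq
  have hm : Measurable fun t : ℝ => c + (∫ u in (0 : ℝ)..t, deriv (periodicLift f) u) -
      ∑ j : Fin k, jump f (β j.castSucc) * (⌊t - β j.castSucc⌋ : ℝ) := by
    refine (measurable_const.add hβ.continuous_integral_deriv.measurable).sub
      (Finset.measurable_sum _ fun j _ => ?_)
    exact measurable_const.mul (measurable_from_top.comp
      (Int.measurable_floor.comp (measurable_id.sub_const _)))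
  refine hm.measurable_of_countable_ne ((countable_singularSet β).mono fun t ht => ?_)
  by_contra hts
  have h := hc t hts
  unfold remainder at h
  exact ht (by linarith)

theorem measurable (hβ : IsPiecewiseAbsolutelyContinuous f β) : Measurable f := by
  have h1 : f = fun x => periodicLift f ((AddCircle.measurableEquivIoc (1 : ℝ) 0 x : ℝ)) := by
    ext x
    unfold periodicLift
    congr 1
    exact ((AddCircle.equivIoc (1 : ℝ) 0).symm_apply_apply x).symm
  rw [h1]
  exact hβ.measurable_periodicLift.comp
    (measurable_subtype_coe.comp (AddCircle.measurableEquivIoc (1 : ℝ) 0).measurable)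

theorem bounded_above (hβ : IsPiecewiseAbsolutelyContinuous f β) : ∃ K, ∀ x, f x ≤ K := by
  have h : ∀ j : Fin k, ∃ K, ∀ t ∈ Ico (β j.castSucc) (β j.succ), periodicLift f t ≤ K := by
    intro j
    obtain ⟨G, hG, hGf, -⟩ := hβ.exists_primitive j 0
    obtain ⟨K, hK⟩ := isCompact_Icc.bddAbove_image hG
    -- Absolute continuity says nothing about the value at the discontinuity itself, which enters
    -- separately.
    refine ⟨max K (periodicLift f (β j.castSucc)), fun t ht => ?_⟩
    rcases eq_or_lt_of_le ht.1 with h | h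
    · rw [h]; exact le_max_right _ _
    · refine le_max_of_le_left ?_
      have ht' : t ∈ Ioo (β j.castSucc + (0 : ℤ)) (β j.succ + (0 : ℤ)) := by
        simpa using ⟨h, ht.2⟩
      rw [← hGf ht']
      exact hK (mem_image_of_mem _ (Ioo_subset_Icc_self ht'))
  choose K hK using h
  obtain ⟨B, hB⟩ := (Set.finite_range K).bddAbove
  refine ⟨B, fun x => ?_⟩
  obtain ⟨t, rfl⟩ := QuotientAddGroup.mk_surjective x
  obtain ⟨j, m, h1, h2⟩ := hβ.exists_arc_right t
  have := hK j (t - m) ⟨by linarith, by linarith⟩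
  rw [periodicLift_sub_intCast] at this
  exact this.trans (hB ⟨j, rfl⟩)

end IsPiecewiseAbsolutelyContinuous

/-! ### Uniform linear growth of Birkhoff integrals over short arcs. -/

/-- A backward orbit segment is a forward one read from its last point. This version counts the
translates of one arc that cover a given point. -/
theorem card_visits_sub_le {α : ℝ} (hα : Irrational α) (hb : BddAbove (partialQuotients α))
    {a : ℝ} (ha0 : 0 < a) (ha1 : a ≤ 1) {n : ℕ} (hn : n * a ≤ 1) (v : ℝ) :
    ((((Finset.range n).filter fun i : ℕ => Int.fract (v - i * α) < a).card : ℕ) : ℝ) ≤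
      2 * quotientBound α + 1 := by
  refine le_trans (le_of_eq ?_) (card_visits_le hα hb ha0 ha1 hn (v - ((n : ℝ) - 1) * α))
  rw [Finset.card_filter, Finset.card_filter, ← Finset.sum_range_reflect]
  congr 1
  refine Finset.sum_congr rfl fun i hi => ?_
  have hi' : i + 1 ≤ n := Finset.mem_range.1 hi
  have e : v - ((n - 1 - i : ℕ) : ℝ) * α = v - ((n : ℝ) - 1) * α + i * α := by
    rw [Nat.sub_sub, Nat.cast_sub (by omega)]
    push_cast; ring
  rw [e]

/-- An integral over a short arc as a weighted integral over the circle. -/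
theorem intervalIntegral_arc_eq {φ : ℝ → ℝ} (hφ : Function.Periodic φ 1)
    (hint : ∀ a b, IntervalIntegrable φ volume a b) {a : ℝ} (ha0 : 0 ≤ a) (ha1 : a ≤ 1) (z : ℝ) :
    ∫ u in z..z + a, φ u = ∫ v in (0 : ℝ)..1, (if Int.fract (v - z) < a then φ v else 0) ∧
    IntervalIntegrable (fun v => if Int.fract (v - z) < a then φ v else 0) volume 0 1 := by
  set ψ : ℝ → ℝ := fun v => if Int.fract (v - z) < a then φ v else 0
  have hψ : Function.Periodic ψ 1 := fun v => by
    simp only [ψ]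
    rw [show v + 1 - z = v - z + 1 by ring, Int.fract_add_one, hφ v]
  have h1 : EqOn ψ φ (Ioo z (z + a)) := fun v hv => by
    have : Int.fract (v - z) = v - z :=
      Int.fract_eq_self.2 ⟨by linarith [hv.1], by linarith [hv.2]⟩
    simp only [ψ]
    rw [this, if_pos (by linarith [hv.2])]
  have h2 : EqOn ψ (fun _ => 0) (Ioo (z + a) (z + 1)) := fun v hv => by
    have : Int.fract (v - z) = v - z :=
      Int.fract_eq_self.2 ⟨by linarith [hv.1], by linarith [hv.2]⟩
    simp only [ψ]
    rw [this, if_neg (by linarith [hv.1])]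
  have ae_of_Ioo : ∀ (χ : ℝ → ℝ) (b c : ℝ), b ≤ c → EqOn ψ χ (Ioo b c) →
      ∀ᵐ v, v ∈ uIoc b c → χ v = ψ v := by
    intro χ b c hbc h
    have h1 : ∀ᵐ v : ℝ, v ≠ c := ae_iff.2 (by simp)
    filter_upwards [h1] with v hv hv'
    rw [uIoc_of_le hbc] at hv'
    exact (h ⟨hv'.1, lt_of_le_of_ne hv'.2 hv⟩).symm
  have e1 := ae_of_Ioo φ z (z + a) (by linarith) h1
  have e2 := ae_of_Ioo (fun _ => 0) (z + a) (z + 1) (by linarith) h2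
  have i1 : IntervalIntegrable ψ volume z (z + a) :=
    (hint z (z + a)).congr_ae ((ae_restrict_iff' measurableSet_uIoc).2 e1)
  have i2 : IntervalIntegrable ψ volume (z + a) (z + 1) :=
    (intervalIntegrable_const (c := (0 : ℝ))).congr_ae
      ((ae_restrict_iff' measurableSet_uIoc).2 e2)
  have i3 := hψ.intervalIntegrable one_ne_zero (i1.trans i2)
  refine ⟨?_, i3 0 1⟩
  have h3 := hψ.intervalIntegral_add_eq 0 z
  rw [zero_add] at h3
  rw [h3, ← intervalIntegral.integral_add_adjacent_intervals i1 i2,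
    ← intervalIntegral.integral_congr_ae e1, ← intervalIntegral.integral_congr_ae e2]
  simp

/-- For `n ≤ 1 / a` the arcs `[x + iα, x + iα + a)`, `i < n`, cover each point at most `2C + 1`
times. -/
theorem sum_intervalIntegral_arc_le {α : ℝ} (hα : Irrational α)
    (hb : BddAbove (partialQuotients α)) {φ : ℝ → ℝ} (hφ : Function.Periodic φ 1)
    (hint : ∀ a b, IntervalIntegrable φ volume a b) (hφ0 : ∀ t, 0 ≤ φ t)
    {a : ℝ} (ha0 : 0 < a) (ha1 : a ≤ 1) {n : ℕ} (hn : n * a ≤ 1) (x : ℝ) :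
    ∑ i ∈ Finset.range n, ∫ u in x..x + a, φ (u + i * α) ≤
      (2 * quotientBound α + 1) * ∫ v in (0 : ℝ)..1, φ v := by
  have h1 : ∀ i ∈ Finset.range n, ∫ u in x..x + a, φ (u + i * α) =
      ∫ v in (0 : ℝ)..1, (if Int.fract (v - (x + i * α)) < a then φ v else 0) := by
    intro i _
    rw [intervalIntegral.integral_comp_add_right, show x + a + i * α = x + i * α + a by ring]
    exact (intervalIntegral_arc_eq hφ hint ha0.le ha1 _).1
  rw [Finset.sum_congr rfl h1, ← intervalIntegral.integral_finsetSum fun i _ =>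
    (intervalIntegral_arc_eq hφ hint ha0.le ha1 _).2, ← intervalIntegral.integral_const_mul]
  refine intervalIntegral.integral_mono_on zero_le_one ?_ ((hint 0 1).const_mul _) fun v _ => ?_
  · have := IntervalIntegrable.sum (Finset.range n) fun i _ =>
      (intervalIntegral_arc_eq hφ hint ha0.le ha1 (x + i * α)).2
    convert! this using 1
    ext v
    simp
  · rw [← Finset.sum_filter, Finset.sum_const, nsmul_eq_mul]
    refine mul_le_mul_of_nonneg_right ?_ (hφ0 v)
    have := card_visits_sub_le hα hb ha0 ha1 hn (v - x)
    simpa only [sub_sub] using this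

theorem fourier_ne_one {α : ℝ} (hα : Irrational α) {l : ℤ} (hl : l ≠ 0) :
    fourier l (α : UnitAddCircle) ≠ 1 := by
  rw [fourier_coe_apply]
  intro h
  obtain ⟨m, hm⟩ := Complex.exp_eq_one_iff.1 h
  have h2 : (2 * Real.pi * Complex.I : ℂ) ≠ 0 := Complex.two_pi_I_ne_zero
  have h3 : (l * α : ℂ) = m := by
    apply mul_left_cancel₀ h2
    rw [mul_comm _ (m : ℂ), ← hm]
    push_cast
    ring
  have h4 : (l * α : ℝ) = m := by exact_mod_cast h3
  exact (hα.intCast_mul hl).ne_int m h4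

/-- Trigonometric polynomials have bounded discrepancy along the rotation. -/
theorem exists_discrepancy_bound {α : ℝ} (hα : Irrational α) {g : C(UnitAddCircle, ℂ)}
    (hg : g ∈ Submodule.span ℂ (range (fourier (T := 1)))) :
    ∃ B : ℝ, ∀ (x : UnitAddCircle) (n : ℕ),
      ‖∑ i ∈ Finset.range n, g (x + i • (α : UnitAddCircle)) - n * ∫ v, g v‖ ≤ B := by
  have hint : ∀ g : C(UnitAddCircle, ℂ), Integrable g := fun g =>
    g.continuous.integrable_of_hasCompactSupport (HasCompactSupport.of_compactSpace g)
  induction hg using Submodule.span_induction with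
  | mem g hg =>
    obtain ⟨l, rfl⟩ := hg
    by_cases hl : l = 0
    · subst hl
      refine ⟨0, fun x n => ?_⟩
      simp [measureReal_def]
    · set z := fourier l (α : UnitAddCircle)
      -- Along an orbit a non-trivial character is a geometric progression of ratio z ≠ 1, whose
      -- partial sums are at most 2/|z - 1|; its mean vanishes by invariance.
      have hz : z ≠ 1 := fourier_ne_one hα hl
      have hmul : ∀ x y : UnitAddCircle, fourier l (x + y) = fourier l x * fourier l y := by
        intro x y
        simp [fourier_apply, AddCircle.toCircle_add]
      have hpow : ∀ i : ℕ, fourier l (i • (α : UnitAddCircle)) = z ^ i := by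
        intro i
        induction i with
        | zero => simp
        | succ i ih => rw [succ_nsmul, hmul, ih, pow_succ]
      have hnorm : ∀ x : UnitAddCircle, ‖fourier l x‖ = 1 := fun x => Circle.norm_coe _
      have hzero : ∫ v : UnitAddCircle, fourier l v = 0 := by
        have h := integral_add_right_eq_self (μ := (volume : Measure UnitAddCircle))
          (fun v => fourier l v) (α : UnitAddCircle)
        simp_rw [hmul, integral_mul_const] at h
        have h' : (∫ v : UnitAddCircle, fourier l v) * (z - 1) = 0 := by
          rw [mul_sub, mul_one]; exact sub_eq_zero.2 h
        exact (mul_eq_zero.1 h').resolve_right (sub_ne_zero.2 hz)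
      refine ⟨2 / ‖z - 1‖, fun x n => ?_⟩
      rw [hzero, mul_zero, sub_zero]
      simp_rw [hmul, hpow]
      rw [← Finset.mul_sum, geom_sum_eq hz, norm_mul, hnorm, one_mul, norm_div]
      gcongr
      refine (norm_sub_le _ _).trans ?_
      rw [norm_pow, hnorm, one_pow, norm_one]
      norm_num
  | zero => exact ⟨0, fun x n => by simp⟩
  | add g₁ g₂ _ _ ih₁ ih₂ =>
    obtain ⟨B₁, h₁⟩ := ih₁
    obtain ⟨B₂, h₂⟩ := ih₂
    refine ⟨B₁ + B₂, fun x n => ?_⟩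
    refine le_trans (le_of_eq ?_) ((norm_add_le _ _).trans (add_le_add (h₁ x n) (h₂ x n)))
    simp only [ContinuousMap.add_apply]
    rw [integral_add (hint g₁) (hint g₂), Finset.sum_add_distrib]
    congr 1; ring
  | smul c g _ ih =>
    obtain ⟨B, h⟩ := ih
    refine ⟨‖c‖ * B, fun x n => ?_⟩
    refine le_trans (le_of_eq ?_) (mul_le_mul_of_nonneg_left (h x n) (norm_nonneg c))
    simp only [ContinuousMap.smul_apply, smul_eq_mul]
    rw [integral_const_mul, ← Finset.mul_sum, ← norm_mul]
    congr 1; ring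

/-- Trigonometric polynomials are dense in `L¹` of the circle. -/
theorem exists_trigPolynomial_near {h : ℝ → ℝ}
    (hint : IntervalIntegrable h volume 0 1) {η : ℝ} (hη : 0 < η) :
    ∃ g ∈ Submodule.span ℂ (range (fourier (T := 1))),
      ∫ v in (0 : ℝ)..1, ‖(h v : ℂ) - g (v : UnitAddCircle)‖ ≤ η := by
  have hLp : MemLp (fun t => (h t : ℂ)) 1 (volume.restrict (Ioc 0 (0 + 1))) := by
    rw [memLp_one_iff_integrable, zero_add]
    exact ((intervalIntegrable_iff_integrableOn_Ioc_of_le zero_le_one).1 hint).ofReal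
  have hH := memLp_haarAddCircle_iff.2 hLp.memLp_liftIoc
  have hvol : (volume : Measure UnitAddCircle) = AddCircle.haarAddCircle := by
    rw [AddCircle.volume_eq_smul_haarAddCircle]; simp
  set H := AddCircle.liftIoc (1 : ℝ) 0 fun t => (h t : ℂ)
  have hmem : hH.toLp H ∈ (Submodule.span ℂ (range (@fourierLp 1 _ 1 _))).topologicalClosure := by
    rw [span_fourierLp_closure_eq_top ENNReal.one_ne_top]; trivial
  obtain ⟨G, hG, hdist⟩ := Metric.mem_closure_iff.1 hmem η hη
  have hspan : (Submodule.span ℂ (range (@fourierLp 1 _ 1 _))) =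
      (Submodule.span ℂ (range (fourier (T := 1)))).map
        (ContinuousMap.toLp (E := ℂ) 1 (AddCircle.haarAddCircle (T := (1 : ℝ))) ℂ).toLinearMap := by
    rw [Submodule.map_span, ← range_comp]
    rfl
  rw [hspan] at hG
  obtain ⟨g, hg, rfl⟩ := hG
  refine ⟨g, hg, ?_⟩
  rw [dist_eq_norm, L1.norm_eq_integral_norm] at hdist
  refine le_trans (le_of_eq ?_) hdist.le
  have e1 : ∫ v in (0 : ℝ)..1, ‖(h v : ℂ) - g (v : UnitAddCircle)‖ =
      ∫ v in (0 : ℝ)..(0 + 1), ‖H (v : UnitAddCircle) - g (v : UnitAddCircle)‖ := by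
    rw [zero_add]
    refine intervalIntegral.integral_congr_ae (Eventually.of_forall fun v hv => ?_)
    rw [uIoc_of_le zero_le_one] at hv
    simp only [H]
    rw [AddCircle.liftIoc_coe_apply (by simpa using hv)]
  rw [e1, UnitAddCircle.intervalIntegral_preimage 0 fun v => ‖H v - g v‖, hvol]
  refine integral_congr_ae ?_
  filter_upwards [Lp.coeFn_sub (hH.toLp H)
    (ContinuousMap.toLp (E := ℂ) 1 (AddCircle.haarAddCircle (T := (1 : ℝ))) ℂ g),
    hH.coeFn_toLp, ContinuousMap.coeFn_toLp (p := 1) (𝕜 := ℂ) AddCircle.haarAddCircle g]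
    with v h1 h2 h3
  have h1' := h1.trans (congrArg₂ (· - ·) h2 h3)
  exact congrArg norm h1'.symm

/-- The Birkhoff integrals over a short arc of length `a` grow linearly, uniformly for times
up to `1 / a`. -/
theorem exists_drift_bound {α : ℝ} (hα : Irrational α)
    (hb : BddAbove (partialQuotients α)) {h : ℝ → ℝ} (hper : Function.Periodic h 1)
    (hint : ∀ a b, IntervalIntegrable h volume a b) {η : ℝ} (hη : 0 < η) :
    ∃ δ > 0, ∀ a : ℝ, 0 < a → a < δ → ∀ (x : ℝ) (n : ℕ), n * a ≤ 1 →
      |∑ i ∈ Finset.range n, (∫ u in x..x + a, h (u + i * α)) -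
        n * a * ∫ v in (0 : ℝ)..1, h v| ≤ η := by
  have hC := two_le_quotientBound hα hb
  set C := quotientBound α
  -- The approximation error is paid 2C + 1 times through the arcs and once through the mean, using
  -- half of η. The other half pays for the discrepancy, at most Ba after integration over an arc of
  -- length a.
  obtain ⟨g, hg, hgh⟩ := exists_trigPolynomial_near (hint 0 1)
    (η := η / (2 * (2 * C + 2))) (by positivity)
  obtain ⟨B, hB⟩ := exists_discrepancy_bound hα hg
  have hB0 : 0 ≤ B := (norm_nonneg _).trans (hB 0 0)
  refine ⟨min 1 (η / (2 * (B + 1))), by positivity, fun a ha0 ha x n hn => ?_⟩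
  have ha1 : a ≤ 1 := (ha.trans_le (min_le_left _ _)).le
  have haB : a * (2 * (B + 1)) ≤ η := by
    rw [← le_div_iff₀ (by positivity)]; exact (ha.trans_le (min_le_right _ _)).le
  set hc : ℝ → ℂ := fun u => (h u : ℂ)
  set gc : ℝ → ℂ := fun u => g (u : UnitAddCircle)
  have hgc : Continuous gc := g.continuous.comp (AddCircle.continuous_mk' 1)
  have ihc : ∀ a b, IntervalIntegrable hc volume a b := fun a b =>
    ⟨(hint a b).1.ofReal, (hint a b).2.ofReal⟩
  have igc : ∀ a b, IntervalIntegrable gc volume a b := fun a b => hgc.intervalIntegrable a b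
  have hcper : Function.Periodic hc 1 := fun u => by simp only [hc, hper u]
  have gcper : Function.Periodic gc 1 := fun u => by simp [gc]
  have ihc' : ∀ (i : ℕ), IntervalIntegrable (fun u => hc (u + i * α)) volume x (x + a) :=
    fun i => by simpa using (ihc (x + i * α) (x + a + i * α)).comp_add_right (i * α)
  have igc' : ∀ (i : ℕ), IntervalIntegrable (fun u => gc (u + i * α)) volume x (x + a) :=
    fun i => by simpa using (igc (x + i * α) (x + a + i * α)).comp_add_right (i * α)
  have hgI : ∫ v : UnitAddCircle, g v = ∫ v in (0 : ℝ)..1, gc v := by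
    rw [← UnitAddCircle.intervalIntegral_preimage 0, zero_add]
  set I : ℂ := ∫ v in (0 : ℝ)..1, gc v
  -- the three error terms
  have t1 : ‖∑ i ∈ Finset.range n, ∫ u in x..x + a, (hc (u + i * α) - gc (u + i * α))‖ ≤
      (2 * C + 1) * (η / (2 * (2 * C + 2))) := by
    refine (norm_sum_le _ _).trans ?_
    refine (Finset.sum_le_sum fun i _ =>
      intervalIntegral.norm_integral_le_integral_norm (by linarith)).trans ?_
    have := sum_intervalIntegral_arc_le hα hb (φ := fun v => ‖hc v - gc v‖)
      (fun v => by simp only [hcper v, gcper v]) (fun a b => ((ihc a b).sub (igc a b)).norm)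
      (fun _ => norm_nonneg _) ha0 ha1 hn x
    refine this.trans ?_
    gcongr
  have t2 : ‖∫ u in x..x + a, (∑ i ∈ Finset.range n, gc (u + i * α) - n * I)‖ ≤ B * a := by
    have := intervalIntegral.norm_integral_le_of_norm_le_const (a := x) (b := x + a) (C := B)
      (f := fun u => ∑ i ∈ Finset.range n, gc (u + i * α) - n * I) fun u _ => ?_
    · simpa [abs_of_pos ha0] using this
    · have h1 := hB (u : UnitAddCircle) n
      rw [hgI] at h1
      convert! h1 using 6 with i
      simp
  have t3 : ‖(n * a : ℂ) * (I - ∫ v in (0 : ℝ)..1, hc v)‖ ≤ η / (2 * (2 * C + 2)) := by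
    rw [← intervalIntegral.integral_sub (igc 0 1) (ihc 0 1), norm_mul]
    have h1 : ‖(n * a : ℂ)‖ ≤ 1 := by
      have : (n * a : ℂ) = ((n * a : ℝ) : ℂ) := by push_cast; rfl
      rw [this, Complex.norm_real, Real.norm_of_nonneg (by positivity)]
      exact hn
    have h2 : ‖∫ v in (0 : ℝ)..1, (gc v - hc v)‖ ≤ η / (2 * (2 * C + 2)) := by
      refine (intervalIntegral.norm_integral_le_integral_norm zero_le_one).trans ?_
      simp_rw [norm_sub_rev (gc _)]
      exact hgh
    calc _ ≤ 1 * (η / (2 * (2 * C + 2))) := by gcongr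
      _ = _ := one_mul _
  have hsplit : ((∑ i ∈ Finset.range n, (∫ u in x..x + a, h (u + i * α)) -
        n * a * ∫ v in (0 : ℝ)..1, h v : ℝ) : ℂ) =
      (∑ i ∈ Finset.range n, ∫ u in x..x + a, (hc (u + i * α) - gc (u + i * α))) +
      (∫ u in x..x + a, (∑ i ∈ Finset.range n, gc (u + i * α) - n * I)) +
      (n * a : ℂ) * (I - ∫ v in (0 : ℝ)..1, hc v) := by
    have e1 : ∀ i ∈ Finset.range n, ∫ u in x..x + a, (hc (u + i * α) - gc (u + i * α)) =
        (∫ u in x..x + a, hc (u + i * α)) - ∫ u in x..x + a, gc (u + i * α) := fun i _ =>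
      intervalIntegral.integral_sub (ihc' i) (igc' i)
    have e2 : ∫ u in x..x + a, (∑ i ∈ Finset.range n, gc (u + i * α) - n * I) =
        (∑ i ∈ Finset.range n, ∫ u in x..x + a, gc (u + i * α)) - a * (n * I) := by
      rw [intervalIntegral.integral_sub _ intervalIntegrable_const,
        intervalIntegral.integral_finsetSum fun i _ => igc' i, intervalIntegral.integral_const]
      · simp
      · have := IntervalIntegrable.sum (Finset.range n) fun i _ => igc' i
        convert! this using 1
        ext v
        simp
    rw [Finset.sum_congr rfl e1, e2, Finset.sum_sub_distrib]
    push_cast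
    simp only [hc, intervalIntegral.integral_ofReal]
    ring
  rw [← Real.norm_eq_abs, ← Complex.norm_real, hsplit]
  refine (norm_add₃_le).trans ?_
  have e : (2 * C + 1) * (η / (2 * (2 * C + 2))) + η / (2 * (2 * C + 2)) = η / 2 := by
    field_simp
    ring
  nlinarith

/-! ### Crossings of discontinuities and windows of frozen drift. -/

theorem floor_add_sub_floor (y : ℝ) {a : ℝ} (ha0 : 0 < a) (ha1 : a ≤ 1) :
    (⌊y + a⌋ : ℝ) - ⌊y⌋ = if Int.fract (y + a) < a then 1 else 0 := by
  have h0 := Int.fract_nonneg (y + a)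
  have h1 := Int.fract_lt_one (y + a)
  have h2 := Int.floor_add_fract (y + a)
  split_ifs with h
  · have : ⌊y⌋ = ⌊y + a⌋ - 1 := by
      rw [Int.floor_eq_iff]; push_cast; constructor <;> linarith
    rw [this]; push_cast; ring
  · have : ⌊y⌋ = ⌊y + a⌋ := by
      rw [Int.floor_eq_iff]; constructor <;> linarith
    rw [this]; ring

/-- A bounded monotone sequence of natural numbers is constant on one of `R + 1` consecutive
blocks. -/
theorem exists_constant_block {s : ℕ → ℕ} (hs : Monotone s) (M₀ L R : ℕ)
    (hR : s (M₀ + (R + 1) * L) ≤ R) :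
    ∃ b ≤ R, s (M₀ + b * L) = s (M₀ + (b + 1) * L) := by
  by_contra! h
  -- If every block raised `s`, the value after R + 1 blocks would exceed R.
  have key : ∀ b ≤ R + 1, b ≤ s (M₀ + b * L) := by
    intro b
    induction b with
    | zero => intro _; exact Nat.zero_le _
    | succ b ih =>
      intro hb
      have h1 := ih (by omega)
      have h2 := h b (by omega)
      have h3 : s (M₀ + b * L) ≤ s (M₀ + (b + 1) * L) := hs (by gcongr; omega)
      omega
  have := key (R + 1) le_rfl
  omega

/-- The number of times the arc `(x + iα, x + a + iα]`, `i < n`, contains `b` modulo one. -/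
def crossings (α x a b : ℝ) (n : ℕ) : ℕ :=
  ((Finset.range n).filter fun i : ℕ => Int.fract (x + a - b + i * α) < a).card

theorem crossings_mono (α x a b : ℝ) : Monotone (crossings α x a b) := fun m n hmn =>
  Finset.card_le_card (Finset.filter_subset_filter _ (by simpa using hmn))

/-- Summation of `sub_eq_integral` along the orbit. Since a ≤ 1, each floor increases by 0 or 1
across an arc, and the increments add up to the number of crossings. -/
theorem IsPiecewiseAbsolutelyContinuous.sum_sub_sum {f : UnitAddCircle → ℝ} {k : ℕ}
    {β : Fin (k + 1) → ℝ} (hβ : IsPiecewiseAbsolutelyContinuous f β) {α x a : ℝ} (ha0 : 0 < a)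
    (ha1 : a ≤ 1) (hx : ∀ i : ℕ, x + i * α ∉ singularSet β)
    (hxa : ∀ i : ℕ, x + a + i * α ∉ singularSet β) (n : ℕ) :
    ∑ i ∈ Finset.range n, periodicLift f (x + a + i * α) -
      ∑ i ∈ Finset.range n, periodicLift f (x + i * α) =
    ∑ i ∈ Finset.range n, (∫ u in x..x + a, deriv (periodicLift f) (u + i * α)) -
      ∑ j : Fin k, crossings α x a (β j.castSucc) n * jump f (β j.castSucc) := by
  rw [← Finset.sum_sub_distrib]
  have h : ∀ i ∈ Finset.range n,
      periodicLift f (x + a + i * α) - periodicLift f (x + i * α) =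
      (∫ u in x..x + a, deriv (periodicLift f) (u + i * α)) - ∑ j : Fin k,
        (if Int.fract (x + a - β j.castSucc + i * α) < a then 1 else 0) *
          jump f (β j.castSucc) := by
    intro i _
    rw [hβ.sub_eq_integral (hx i) (hxa i), intervalIntegral.integral_comp_add_right]
    congr 1
    refine Finset.sum_congr rfl fun j _ => ?_
    have := floor_add_sub_floor (x + i * α - β j.castSucc) ha0 ha1
    rw [show x + i * α - β j.castSucc + a = x + a + i * α - β j.castSucc by ring] at this
    rw [this, mul_comm, show x + a + i * α - β j.castSucc = x + a - β j.castSucc + i * α by ring]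
  rw [Finset.sum_congr rfl h, Finset.sum_sub_distrib, Finset.sum_comm]
  congr 1
  refine Finset.sum_congr rfl fun j _ => ?_
  rw [← Finset.sum_mul, Finset.sum_boole]
  rfl

/-- On a window of times comparable to `1 / a`, the Birkhoff sums at `x` and `x + a` differ by an
almost constant amount `sgn(S) p - d`, `d ∈ D`. -/
theorem exists_window {α : ℝ} (hα : Irrational α) (hb : BddAbove (partialQuotients α))
    {f : UnitAddCircle → ℝ} {k : ℕ} {β : Fin (k + 1) → ℝ}
    (hβ : IsPiecewiseAbsolutelyContinuous f β) {p : ℝ} (hp0 : 0 < p)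
    (hpS : p < |sumOfJumps f β|) {ε : ℝ} (hε : 0 < ε) :
    ∃ κ > (0 : ℝ), ∀ N : ℕ, ∃ δ > (0 : ℝ), ∀ x a : ℝ, 0 < a → a < δ →
      (∀ i : ℕ, x + i * α ∉ singularSet β) → (∀ i : ℕ, x + a + i * α ∉ singularSet β) →
      ∃ M L : ℕ, N ≤ M ∧ N ≤ L ∧ κ * M ≤ L ∧ ∃ d ∈ jumpSums α f β, ∀ n, M ≤ n → n ≤ M + L →
        |∑ i ∈ Finset.range n, periodicLift f (x + a + i * α) -
          ∑ i ∈ Finset.range n, periodicLift f (x + i * α) -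
          (Real.sign (sumOfJumps f β) * p - d)| < ε := by
  set S := sumOfJumps f β
  have hS : 0 < |S| := hp0.trans hpS
  have hC := two_le_quotientBound hα hb
  -- A bound for the total number of crossings at all discontinuities up to time 1/a.
  set R : ℕ := k * ⌊2 * quotientBound α + 1⌋₊ with hRdef
  -- The variation of na|S| allowed over the range of times. The bound ε / 4 controls the error; p /
  -- 2 makes the range start no earlier than its own length, hence beyond N.
  set ε₁ := min (ε / 4) (p / 2)
  have hε₁ : 0 < ε₁ := by positivity
  have hε₁ε : ε₁ ≤ ε / 4 := min_le_left _ _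
  have hε₁p : ε₁ ≤ p / 2 := min_le_right _ _
  obtain ⟨δ₀, hδ₀, hdrift⟩ := exists_drift_bound hα hb (periodic_deriv_periodicLift f)
    hβ.intervalIntegrable_deriv (η := ε / 4) (by positivity)
  rw [hβ.integral_deriv_eq_sumOfJumps] at hdrift
  -- Blocks have length at least T/(2(R + 1)) with T = ε₁/(|S|a), and start no later than p/(|S|a);
  -- this is the quotient.
  refine ⟨ε₁ / (2 * p * (R + 1)), by positivity, fun N => ?_⟩
  refine ⟨min (min 1 δ₀) (ε₁ / (2 * |S| * (R + 3) * (N + 1))), by positivity,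
    fun x a ha0 ha hx hxa => ?_⟩
  have ha1 : a ≤ 1 := (ha.trans_le ((min_le_left _ _).trans (min_le_left _ _))).le
  have haδ : a < δ₀ := ha.trans_le ((min_le_left _ _).trans (min_le_right _ _))
  have haN : a < ε₁ / (2 * |S| * (R + 3) * (N + 1)) := ha.trans_le (min_le_right _ _)
  have hSa : 0 < |S| * a := by positivity
  -- `T = ε₁ / (|S| a)` is large
  set T := ε₁ / (|S| * a) with hT
  have hTbig : 2 * (R + 3) * (N + 1) ≤ T := by
    rw [hT, le_div_iff₀ hSa]
    rw [lt_div_iff₀ (by positivity)] at haN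
    linarith
  have hR0 : (0 : ℝ) ≤ R := Nat.cast_nonneg R
  have hN0 : (0 : ℝ) ≤ N := Nat.cast_nonneg N
  -- For M₀ ≤ n ≤ M₁ the quantity na|S| lies in [p - ε₁, p].
  set M₀ := ⌈(p - ε₁) / (|S| * a)⌉₊
  set M₁ := ⌊p / (|S| * a)⌋₊
  have hpT : p / (|S| * a) = (p - ε₁) / (|S| * a) + T := by rw [hT]; ring
  have hM₀ : (M₀ : ℝ) < (p - ε₁) / (|S| * a) + 1 :=
    Nat.ceil_lt_add_one (div_nonneg (by linarith) hSa.le)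
  have hM₀' : (p - ε₁) / (|S| * a) ≤ M₀ := Nat.le_ceil _
  have hM₁ : (M₁ : ℝ) ≤ p / (|S| * a) := Nat.floor_le (by positivity)
  have hM₁' : p / (|S| * a) < M₁ + 1 := Nat.lt_floor_add_one _
  have hTN : 2 * (R + 3) + 2 * N ≤ T := by nlinarith [mul_nonneg hR0 hN0]
  have hle : M₀ ≤ M₁ := by
    have : (M₀ : ℝ) ≤ M₁ := by linarith
    exact_mod_cast this
  set L := (M₁ - M₀) / (R + 1)
  have hL1 : M₀ + (R + 1) * L ≤ M₁ := by
    have := Nat.mul_div_le (M₁ - M₀) (R + 1)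
    change (R + 1) * L ≤ M₁ - M₀ at this
    omega
  have hL2 : (M₁ : ℝ) - M₀ < (R + 1) * (L + 1) := by
    have h1 := Nat.lt_mul_div_succ (M₁ - M₀) (Nat.succ_pos R)
    change M₁ - M₀ < (R + 1) * (L + 1) at h1
    have h2 : M₁ < (R + 1) * (L + 1) + M₀ := by omega
    have h3 : (M₁ : ℝ) < (R + 1) * (L + 1) + M₀ := by exact_mod_cast h2
    linarith
  have hL3 : T / 2 ≤ (R + 1) * L := by linarith
  have htime : ∀ n : ℕ, n ≤ M₁ → n * a * |S| ≤ p := by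
    intro n hn
    have : (n : ℝ) ≤ M₁ := by exact_mod_cast hn
    have := this.trans hM₁
    rw [le_div_iff₀ hSa] at this
    linarith
  -- The place where p < |S| is needed: the covering bounds hold only up to time 1/a.
  have htime1 : ∀ n : ℕ, n ≤ M₁ → n * a ≤ 1 := by
    intro n hn
    have := htime n hn
    by_contra! hgt
    nlinarith
  have hcross : ∀ n ≤ M₁, ∀ j : Fin k,
      (crossings α x a (β j.castSucc) n : ℝ) ≤ 2 * quotientBound α + 1 := fun n hn j =>
    card_visits_le hα hb ha0 ha1 (htime1 n hn) _
  set s : ℕ → ℕ := fun n => ∑ j : Fin k, crossings α x a (β j.castSucc) n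
  have hs : Monotone s := fun m n hmn => Finset.sum_le_sum fun j _ => crossings_mono _ _ _ _ hmn
  have hsR : s (M₀ + (R + 1) * L) ≤ R := by
    refine (Finset.sum_le_card_nsmul _ _ ⌊2 * quotientBound α + 1⌋₊ fun j _ =>
      Nat.le_floor (hcross _ hL1 j)).trans ?_
    simp [hRdef]
  obtain ⟨b, hbR, hbs⟩ := exists_constant_block hs M₀ L R hsR
  have hbL : M₀ + (b + 1) * L ≤ M₁ := le_trans (by gcongr) hL1
  have hMM : M₀ + b * L + L = M₀ + (b + 1) * L := by ring
  have hbL' : M₀ + b * L ≤ M₁ := (Nat.le_add_right _ _).trans (hMM.le.trans hbL)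
  refine ⟨M₀ + b * L, L, ?_, ?_, ?_, ∑ j : Fin k, crossings α x a (β j.castSucc) (M₀ + b * L) *
    jump f (β j.castSucc), ⟨fun j => crossings α x a (β j.castSucc) (M₀ + b * L), fun j => ?_, rfl⟩,
    fun n hn1 hn2 => ?_⟩
  · have h1 : T ≤ (p - ε₁) / (|S| * a) := by rw [hT]; gcongr; linarith
    have h2 : (N : ℝ) ≤ M₀ := by linarith
    have h3 : N ≤ M₀ := by exact_mod_cast h2
    exact h3.trans (Nat.le_add_right _ _)
  · have h1 : (R + 1) * (N : ℝ) ≤ (R + 1) * L := by nlinarith [mul_nonneg hR0 hN0]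
    exact_mod_cast le_of_mul_le_mul_left h1 (by positivity)
  · have h1 : ((M₀ + b * L : ℕ) : ℝ) ≤ p / (|S| * a) := le_trans (by exact_mod_cast hbL') hM₁
    rw [div_mul_eq_mul_div, div_le_iff₀ (by positivity)]
    calc ε₁ * ((M₀ + b * L : ℕ) : ℝ) ≤ ε₁ * (p / (|S| * a)) := by gcongr
      _ = p * T := by rw [hT]; ring
      _ ≤ _ := by nlinarith
  · exact hcross _ hbL' j
  · have hnM₁ : n ≤ M₁ := hn2.trans (hMM.le.trans hbL)
    have hsn : s (M₀ + b * L) = s n :=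
      le_antisymm (hs hn1) ((hs (hMM ▸ hn2)).trans hbs.symm.le)
    -- A sum of monotone counts can stay constant only if each of them does.
    have hcn : ∀ j : Fin k, crossings α x a (β j.castSucc) (M₀ + b * L) =
        crossings α x a (β j.castSucc) n := by
      have := (Finset.sum_eq_sum_iff_of_le fun (j : Fin k) _ =>
        crossings_mono α x a (β j.castSucc) hn1).1 hsn
      exact fun j => this j (Finset.mem_univ j)
    simp_rw [hcn]
    rw [hβ.sum_sub_sum ha0 ha1 hx hxa]
    have h1 := hdrift a ha0 haδ x n (htime1 n hnM₁)
    have h2 : |n * a * S - Real.sign S * p| ≤ ε / 4 := by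
      have e : n * a * S - Real.sign S * p = Real.sign S * (n * a * |S| - p) := by
        have : S = Real.sign S * |S| := by
          rcases lt_or_gt_of_ne (abs_pos.1 hS) with h | h
          · rw [Real.sign_of_neg h, abs_of_neg h]; ring
          · rw [Real.sign_of_pos h, abs_of_pos h]; ring
        nth_rw 1 [this]; ring
      have hsign : |Real.sign S| = 1 := by
        rcases lt_or_gt_of_ne (abs_pos.1 hS) with h | h
        · rw [Real.sign_of_neg h]; simp
        · rw [Real.sign_of_pos h]; simp
      rw [e, abs_mul, hsign, one_mul, abs_le]
      have h3 := htime n hnM₁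
      have h4 : (M₀ : ℝ) ≤ n := by exact_mod_cast (Nat.le_add_right _ _).trans hn1
      have h5 := hM₀'.trans h4
      rw [div_le_iff₀ hSa] at h5
      constructor <;> linarith
    rw [abs_le] at h1 h2
    rw [abs_lt]
    constructor <;> linarith [h1.1, h1.2, h2.1, h2.2]

theorem finite_jumpSums (α : ℝ) (f : UnitAddCircle → ℝ) {k : ℕ} (β : Fin (k + 1) → ℝ) :
    (jumpSums α f β).Finite := by
  have h : ((Set.pi univ fun _ : Fin k => {m : ℕ | (m : ℝ) ≤
      2 * (sSup (partialQuotients α) + 1) + 1})).Finite := by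
    refine Set.Finite.pi fun j => (Set.finite_Iic ⌊2 * (sSup (partialQuotients α) + 1) + 1⌋₊).subset
      fun m hm => Nat.le_floor hm
  refine (h.image fun n => ∑ j : Fin k, (n j : ℝ) * jump f (β j.castSucc)).subset ?_
  rintro _ ⟨n, hn, rfl⟩
  exact ⟨n, fun j _ => hn j, rfl⟩

/-! ### Maximal inequality and visits to small sets without ergodicity. -/

section MaximalErgodic

variable {X : Type*}

/-- The maximum of the Birkhoff sums `S_0 g, …, S_n g`. -/
def maxBirkhoffSum (Ψ : X → X) (g : X → ℝ) : ℕ → X → ℝ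
  | 0, _ => 0
  | n + 1, x => max 0 (g x + maxBirkhoffSum Ψ g n (Ψ x))

theorem maxBirkhoffSum_nonneg (Ψ : X → X) (g : X → ℝ) (n : ℕ) (x : X) :
    0 ≤ maxBirkhoffSum Ψ g n x := by
  cases n with
  | zero => exact le_rfl
  | succ n => exact le_max_left _ _

theorem maxBirkhoffSum_le_succ (Ψ : X → X) (g : X → ℝ) (n : ℕ) (x : X) :
    maxBirkhoffSum Ψ g n x ≤ maxBirkhoffSum Ψ g (n + 1) x := by
  induction n generalizing x with
  | zero => exact maxBirkhoffSum_nonneg _ _ _ _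
  | succ n ih => exact max_le_max le_rfl (by linarith [ih (Ψ x)])

theorem birkhoffSum_le_maxBirkhoffSum (Ψ : X → X) (g : X → ℝ) (n : ℕ) (x : X) :
    birkhoffSum Ψ g n x ≤ maxBirkhoffSum Ψ g n x := by
  induction n generalizing x with
  | zero => simp [maxBirkhoffSum]
  | succ n ih =>
    rw [birkhoffSum_succ']
    exact le_max_of_le_right (by linarith [ih (Ψ x)])

variable [MeasurableSpace X] {μ : Measure X} {Ψ : X → X}

theorem integrable_maxBirkhoffSum (hΨ : MeasurePreserving Ψ μ μ) {g : X → ℝ}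
    (hg : Integrable g μ) (n : ℕ) : Integrable (maxBirkhoffSum Ψ g n) μ := by
  induction n with
  | zero => exact integrable_zero X ℝ μ
  | succ n ih =>
    have h := hg.add (hΨ.integrable_comp_of_integrable ih)
    exact (integrable_zero X ℝ μ).sup h

theorem measurable_maxBirkhoffSum (hΨ : Measurable Ψ) {g : X → ℝ}
    (hg : Measurable g) (n : ℕ) : Measurable (maxBirkhoffSum Ψ g n) := by
  induction n with
  | zero => exact measurable_const
  | succ n ih => exact measurable_const.max (hg.add (ih.comp hΨ))

/-- The maximal ergodic theorem. -/
theorem setIntegral_maxBirkhoffSum_nonneg (hΨ : MeasurePreserving Ψ μ μ) {g : X → ℝ}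
    (hgm : Measurable g) (hg : Integrable g μ) (n : ℕ) :
    0 ≤ ∫ x in {x | 0 < maxBirkhoffSum Ψ g (n + 1) x}, g x ∂μ := by
  set F := maxBirkhoffSum Ψ g (n + 1)
  have hF : Integrable F μ := integrable_maxBirkhoffSum hΨ hg _
  have hFm : Measurable F := measurable_maxBirkhoffSum hΨ.measurable hgm _
  have hA : MeasurableSet {x | 0 < F x} := measurableSet_lt measurable_const hFm
  have hFΨ : Integrable (fun x => F (Ψ x)) μ := hΨ.integrable_comp_of_integrable hF
  have h0 : ∫ x, (F x - F (Ψ x)) ∂μ = 0 := by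
    rw [integral_sub hF hFΨ]
    have h := integral_map (μ := μ) (f := F) hΨ.measurable.aemeasurable
      (by rw [hΨ.map_eq]; exact hF.aestronglyMeasurable)
    rw [hΨ.map_eq] at h
    rw [← h, sub_self]
  rw [← integral_indicator hA]
  refine h0.symm.le.trans ?_
  -- Where F > 0 the recursion gives F ≤ g + F ∘ Ψ, and elsewhere F - F ∘ Ψ ≤ 0; the left-hand side
  -- integrates to zero by invariance.
  refine integral_mono (hF.sub hFΨ) (hg.indicator hA) fun x => ?_
  by_cases hx : 0 < F x
  · rw [indicator_of_mem (by exact hx)]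
    have h1 : F x = max 0 (g x + maxBirkhoffSum Ψ g n (Ψ x)) := rfl
    have h2 : F x = g x + maxBirkhoffSum Ψ g n (Ψ x) := by
      rw [h1] at hx ⊢
      exact max_eq_right (le_of_lt (by simpa using hx))
    have h3 := maxBirkhoffSum_le_succ Ψ g n (Ψ x)
    change maxBirkhoffSum Ψ g n (Ψ x) ≤ F (Ψ x) at h3
    linarith
  · rw [indicator_of_notMem (by exact hx)]
    have h1 : 0 ≤ F (Ψ x) := maxBirkhoffSum_nonneg _ _ _ _
    linarith

/-- The maximal ergodic theorem for r - c makes the integral of r over the set at least c times its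
measure. -/
theorem measureReal_maxBirkhoffSum_le [IsProbabilityMeasure μ] (hΨ : MeasurePreserving Ψ μ μ)
    {r : X → ℝ} (hrm : Measurable r) (hr : Integrable r μ) (hr0 : ∀ x, 0 ≤ r x) {c : ℝ}
    (hc : 0 < c) (n : ℕ) :
    μ.real {x | 0 < maxBirkhoffSum Ψ (fun x => r x - c) n x} ≤ (∫ x, r x ∂μ) / c := by
  cases n with
  | zero =>
    simp only [maxBirkhoffSum, lt_self_iff_false, ofPred_false, measureReal_empty]
    exact div_nonneg (integral_nonneg hr0) hc.le
  | succ n =>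
    have hg : Integrable (fun x => r x - c) μ := hr.sub (integrable_const c)
    have h := setIntegral_maxBirkhoffSum_nonneg hΨ (hrm.sub_const c) hg n
    set A := {x | 0 < maxBirkhoffSum Ψ (fun x => r x - c) (n + 1) x}
    rw [integral_sub hr.integrableOn (integrable_const c).integrableOn, setIntegral_const,
      smul_eq_mul] at h
    have h2 : ∫ x in A, r x ∂μ ≤ ∫ x, r x ∂μ :=
      setIntegral_le_integral hr (Eventually.of_forall hr0)
    rw [le_div_iff₀ hc]
    linarith

/-- The weak type maximal inequality for Birkhoff sums. -/
theorem exists_maximal_set [IsProbabilityMeasure μ] (hΨ : MeasurePreserving Ψ μ μ)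
    {r : X → ℝ} (hrm : Measurable r) (hr : Integrable r μ) (hr0 : ∀ x, 0 ≤ r x) {c : ℝ}
    (hc : 0 < c) :
    ∃ E : Set X, MeasurableSet E ∧ μ.real E ≤ (∫ x, r x ∂μ) / c ∧
      ∀ x ∉ E, ∀ n, birkhoffSum Ψ r n x ≤ n * c := by
  set A : ℕ → Set X := fun n => {x | 0 < maxBirkhoffSum Ψ (fun x => r x - c) n x}
  have hAm : ∀ n, MeasurableSet (A n) := fun n =>
    measurableSet_lt measurable_const (measurable_maxBirkhoffSum hΨ.measurable (hrm.sub_const c) n)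
  have hmono : Monotone A := monotone_nat_of_le_succ fun n x hx =>
    lt_of_lt_of_le hx (maxBirkhoffSum_le_succ _ _ _ _)
  refine ⟨⋃ n, A n, MeasurableSet.iUnion hAm, ?_, fun x hx n => ?_⟩
  · have h := tendsto_measure_iUnion_atTop (μ := μ) hmono
    have h' := (ENNReal.tendsto_toReal (measure_ne_top μ _)).comp h
    exact le_of_tendsto h' (Eventually.of_forall fun n =>
      measureReal_maxBirkhoffSum_le hΨ hrm hr hr0 hc n)
  · have h1 : ¬ 0 < maxBirkhoffSum Ψ (fun x => r x - c) n x := fun h =>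
      hx (mem_iUnion.2 ⟨n, h⟩)
    have h2 := birkhoffSum_le_maxBirkhoffSum Ψ (fun x => r x - c) n x
    have h3 : birkhoffSum Ψ (fun x => r x - c) n x = birkhoffSum Ψ r n x - n * c := by
      simp [birkhoffSum, Finset.sum_sub_distrib]
    rw [h3] at h2
    linarith [not_lt.1 h1]

/-- A consequence of von Neumann's mean ergodic theorem: Birkhoff averages are close in `L¹` to
an invariant function. -/
theorem exists_invariant_near_birkhoffAverage [IsProbabilityMeasure μ]
    (hΨ : MeasurePreserving Ψ μ μ) {g : X → ℝ} (hg : MemLp g 2 μ)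
    {η : ℝ} (hη : 0 < η) :
    ∃ K : ℕ, 0 < K ∧ ∃ Q : X → ℝ, Measurable Q ∧ Integrable Q μ ∧ Q ∘ Ψ =ᵐ[μ] Q ∧
      ∫ x, |birkhoffAverage ℝ Ψ g K x - Q x| ∂μ ≤ η := by
  set U : Lp ℝ 2 μ →L[ℝ] Lp ℝ 2 μ :=
    (Lp.compMeasurePreservingₗᵢ ℝ Ψ hΨ).toContinuousLinearMap
  have hU : ‖U‖ ≤ 1 := LinearIsometry.norm_toContinuousLinearMap_le _
  have hUapp : ∀ G : Lp ℝ 2 μ, U G =ᵐ[μ] G ∘ Ψ := fun G => Lp.coeFn_compMeasurePreserving G hΨ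
  have ht := U.tendsto_birkhoffAverage_orthogonalProjection hU (hg.toLp g)
  set PG := (U.eqLocus (1 : Lp ℝ 2 μ →L[ℝ] Lp ℝ 2 μ)).orthogonalProjectionOnto (hg.toLp g)
  obtain ⟨K, hK⟩ := Filter.eventually_atTop.1 (Metric.tendsto_nhds.1 ht η hη)
  have hK' := hK (K + 1) (Nat.le_succ K)
  set Q₀ : Lp ℝ 2 μ := (PG : Lp ℝ 2 μ)
  have hinv : U Q₀ = Q₀ := PG.2
  have hQ₀ : MemLp Q₀ 2 μ := Lp.memLp Q₀
  -- A genuinely measurable representative, so that sets defined through `Q` are measurable; its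
  -- invariance holds only almost everywhere.
  set Q : X → ℝ := hQ₀.aestronglyMeasurable.mk Q₀
  have hQQ : Q₀ =ᵐ[μ] Q := hQ₀.aestronglyMeasurable.ae_eq_mk
  have hQint : Integrable Q μ := (hQ₀.integrable one_le_two).congr hQQ
  refine ⟨K + 1, Nat.succ_pos K, Q, hQ₀.aestronglyMeasurable.stronglyMeasurable_mk.measurable,
    hQint, ?_, ?_⟩
  · have h1 := hΨ.quasiMeasurePreserving.ae_eq_comp hQQ
    have h2 := hUapp Q₀
    rw [hinv] at h2
    exact h1.symm.trans (h2.symm.trans hQQ)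
  · have hiter : ∀ i : ℕ, ((U^[i] (hg.toLp g) : Lp ℝ 2 μ) : X → ℝ) =ᵐ[μ] g ∘ Ψ^[i] := by
      intro i
      induction i with
      | zero => exact hg.coeFn_toLp
      | succ i ih =>
        rw [Function.iterate_succ_apply', Function.iterate_succ, ← Function.comp_assoc]
        exact (hUapp _).trans (hΨ.quasiMeasurePreserving.ae_eq_comp ih)
    have hsum : ∀ n : ℕ, ((birkhoffSum U _root_.id n (hg.toLp g) : Lp ℝ 2 μ) : X → ℝ) =ᵐ[μ]
        birkhoffSum Ψ g n := by
      intro n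
      induction n with
      | zero => exact Lp.coeFn_zero ℝ 2 μ
      | succ n ih =>
        rw [birkhoffSum_succ]
        filter_upwards [Lp.coeFn_add (birkhoffSum U _root_.id n (hg.toLp g))
          (_root_.id (U^[n] (hg.toLp g))), ih, hiter n] with x h1 h2 h3
        rw [h1, Pi.add_apply, h2, birkhoffSum_succ]
        exact congrArg _ h3
    have havg : ((birkhoffAverage ℝ U _root_.id (K + 1) (hg.toLp g) : Lp ℝ 2 μ) : X → ℝ) =ᵐ[μ]
        birkhoffAverage ℝ Ψ g (K + 1) := by
      filter_upwards [Lp.coeFn_smul (((K + 1 : ℕ) : ℝ)⁻¹)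
        (birkhoffSum U _root_.id (K + 1) (hg.toLp g)), hsum (K + 1)] with x h1 h2
      rw [birkhoffAverage, h1, Pi.smul_apply, h2]
      rfl
    rw [dist_eq_norm] at hK'
    set W := birkhoffAverage ℝ U _root_.id (K + 1) (hg.toLp g) - Q₀
    have hW : (W : X → ℝ) =ᵐ[μ] fun x => birkhoffAverage ℝ Ψ g (K + 1) x - Q x := by
      filter_upwards [Lp.coeFn_sub (birkhoffAverage ℝ U _root_.id (K + 1) (hg.toLp g)) Q₀,
        havg, hQQ] with x h1 h2 h3
      rw [h1, Pi.sub_apply, h2, h3]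
    have h1 : ∫ x, |birkhoffAverage ℝ Ψ g (K + 1) x - Q x| ∂μ = ∫ x, ‖W x‖ ∂μ := by
      refine integral_congr_ae ?_
      filter_upwards [hW] with x hx
      rw [hx, Real.norm_eq_abs]
    have hWm := Lp.memLp W
    rw [h1]
    refine le_trans ?_ hK'.le
    have h2 : eLpNorm W 1 μ ≤ eLpNorm W 2 μ :=
      eLpNorm_le_eLpNorm_of_exponent_le one_le_two hWm.aestronglyMeasurable
    rw [integral_norm_eq_lintegral_enorm hWm.aestronglyMeasurable, ← eLpNorm_one_eq_lintegral_enorm,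
      Lp.norm_def]
    exact ENNReal.toReal_mono hWm.eLpNorm_ne_top h2

open Classical in
/-- Frequency of visits to a small set over windows `[M, M + L)` with `L ≥ κ M`. -/
theorem exists_visit_frequency_bound [IsProbabilityMeasure μ] (hΨ : MeasurePreserving Ψ μ μ)
    {B : Set X} (hB : MeasurableSet B) {ε κ σ : ℝ} (hε : 0 < ε) (hκ : 0 < κ) (hσ : 0 < σ)
    (hμB : μ.real B ≤ ε * σ / 8) :
    ∃ N₀ : ℕ, ∃ G : Set X, MeasurableSet G ∧ μ.real Gᶜ ≤ σ ∧ ∀ x ∈ G, ∀ M L : ℕ, N₀ ≤ L →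
      κ * M ≤ L →
      (((Finset.range L).filter fun m => Ψ^[M + m] x ∈ B).card : ℝ) ≤ ε * L := by
  set g : X → ℝ := B.indicator 1
  have hgm : Measurable g := measurable_one.indicator hB
  have hg01 : ∀ x, 0 ≤ g x ∧ g x ≤ 1 := fun x => by
    by_cases hx : x ∈ B <;> simp [g, hx]
  have hg : MemLp g 2 μ := MemLp.of_bound hgm.aestronglyMeasurable 1
    (Eventually.of_forall fun x => by
      rw [Real.norm_of_nonneg (hg01 x).1]; exact (hg01 x).2)
  -- The maximal inequality controls sums over [0, M + L), and M + L ≤ (1 + 1/κ)L. Thus κ only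
  -- dictates how well `Q` approximates, that is, the choice of `K`; the hypothesis on the measure
  -- of `B` is free of it.
  set c : ℝ := ε / (4 * (1 + 1 / κ))
  have hc : 0 < c := by positivity
  obtain ⟨K, hK, Q, hQm, hQi, hQinv, hQ⟩ := exists_invariant_near_birkhoffAverage hΨ hg
    (η := min (c * σ / 4) (ε * σ / 16)) (by positivity)
  have hKR : (0 : ℝ) < K := by exact_mod_cast hK
  set A : X → ℝ := birkhoffAverage ℝ Ψ g K
  have hiterm : ∀ i, Measurable Ψ^[i] := fun i => hΨ.measurable.iterate i
  have hA_def : ∀ x, A x = (K : ℝ)⁻¹ * ∑ i ∈ Finset.range K, g (Ψ^[i] x) := fun x => rfl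
  have hAm : Measurable A := by
    have : A = fun x => (K : ℝ)⁻¹ * ∑ i ∈ Finset.range K, g (Ψ^[i] x) := funext hA_def
    rw [this]
    exact measurable_const.mul (Finset.measurable_sum _ fun i _ => hgm.comp (hiterm i))
  have hgi : Integrable g μ := hg.integrable one_le_two
  have hgii : ∀ i : ℕ, Integrable (fun x => g (Ψ^[i] x)) μ := fun i =>
    (hΨ.iterate i).integrable_comp_of_integrable hgi
  have hgint : ∀ i : ℕ, ∫ x, g (Ψ^[i] x) ∂μ = μ.real B := fun i => by
    have h := integral_map (μ := μ) (f := g) (hiterm i).aemeasurable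
      hgm.aestronglyMeasurable
    rw [(hΨ.iterate i).map_eq] at h
    rw [← h, integral_indicator_one hB]
  have hAi : Integrable A μ := by
    have : A = fun x => (K : ℝ)⁻¹ * ∑ i ∈ Finset.range K, g (Ψ^[i] x) := funext hA_def
    rw [this]
    exact (integrable_finsetSum _ fun i _ => hgii i).const_mul _
  have hAint : ∫ x, A x ∂μ = μ.real B := by
    simp_rw [hA_def]
    rw [integral_const_mul, integral_finsetSum _ fun i _ => hgii i]
    simp_rw [hgint]
    simp only [Finset.sum_const, Finset.card_range, nsmul_eq_mul]
    field_simp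
  have hA0 : ∀ x, 0 ≤ A x := fun x => by
    rw [hA_def]
    exact mul_nonneg (by positivity) (Finset.sum_nonneg fun i _ => (hg01 _).1)
  have hri : Integrable (fun x => |A x - Q x|) μ := (hAi.sub hQi).abs
  obtain ⟨E₁, hE₁m, hE₁, hE₁b⟩ := exists_maximal_set hΨ (hAm.sub hQm).abs hri
    (fun x => abs_nonneg _) hc
  -- Small by Markov's inequality: ∫ |Q| is at most ∫ A, which is the measure of `B`, plus the
  -- approximation error.
  set E₂ : Set X := {x | ε / 4 ≤ |Q x|}
  have hE₂m : MeasurableSet E₂ := measurableSet_le measurable_const hQm.abs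
  have hQabs : ∫ x, |Q x| ∂μ ≤ ε * σ / 16 + ε * σ / 8 := by
    calc ∫ x, |Q x| ∂μ ≤ ∫ x, (|A x - Q x| + A x) ∂μ := by
          refine integral_mono hQi.abs (hri.add hAi) fun x => ?_
          have := abs_sub_abs_le_abs_sub (Q x) (A x)
          rw [abs_sub_comm, abs_of_nonneg (hA0 x)] at this
          change |Q x| ≤ |A x - Q x| + A x
          linarith
      _ = (∫ x, |A x - Q x| ∂μ) + ∫ x, A x ∂μ := integral_add hri hAi
      _ ≤ _ := by
        rw [hAint]
        exact add_le_add (hQ.trans (min_le_right _ _)) hμB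
  have hE₂ : μ.real E₂ ≤ 3 * σ / 4 := by
    have h := mul_meas_ge_le_integral_of_nonneg (μ := μ) (Eventually.of_forall fun x =>
      abs_nonneg (Q x)) hQi.abs (ε / 4)
    change ε / 4 * μ.real E₂ ≤ _ at h
    have h2 : ε / 4 * μ.real E₂ ≤ ε / 4 * (3 * σ / 4) := by linarith
    exact le_of_mul_le_mul_left h2 (by positivity)
  have hE₁' : μ.real E₁ ≤ σ / 4 := by
    refine hE₁.trans ?_
    rw [div_le_iff₀ hc]
    refine (hQ.trans (min_le_left _ _)).trans (le_of_eq ?_)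
    ring
  set E₃ : Set X := ⋃ i : ℕ, {x | Q (Ψ^[i] x) ≠ Q x}
  have hE₃m : MeasurableSet E₃ := MeasurableSet.iUnion fun i =>
    (measurableSet_eq_fun (hQm.comp (hiterm i)) hQm).compl
  have hE₃ : μ.real E₃ = 0 := by
    have h0 : ∀ i : ℕ, Q ∘ Ψ^[i] =ᵐ[μ] Q := by
      intro i
      induction i with
      | zero => exact EventuallyEq.rfl
      | succ i ih =>
        rw [Function.iterate_succ, ← Function.comp_assoc]
        exact (hΨ.quasiMeasurePreserving.ae_eq_comp ih).trans hQinv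
    have : μ E₃ = 0 := measure_iUnion_null fun i => h0 i
    rw [measureReal_def, this, ENNReal.toReal_zero]
  -- Replacing g by its average over K steps costs at most K in a window, which is at most εL/2 once
  -- L ≥ 2K/ε.
  refine ⟨⌈2 * K / ε⌉₊, (E₁ ∪ E₂ ∪ E₃)ᶜ, ((hE₁m.union hE₂m).union hE₃m).compl, ?_, ?_⟩
  · rw [compl_compl]
    have h1 := measureReal_union_le (μ := μ) (E₁ ∪ E₂) E₃
    have h2 := measureReal_union_le (μ := μ) E₁ E₂
    linarith
  · intro x hx M L hL hML
    simp only [mem_compl_iff, mem_union, not_or] at hx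
    obtain ⟨⟨hx1, hx2⟩, hx3⟩ := hx
    have hLK : 2 * K ≤ ε * L := by
      have := (Nat.le_ceil (2 * K / ε)).trans (by exact_mod_cast hL : (_ : ℝ) ≤ (L : ℝ))
      rw [div_le_iff₀ hε] at this
      linarith
    have hcard : (((Finset.range L).filter fun m => Ψ^[M + m] x ∈ B).card : ℝ) =
        ∑ m ∈ Finset.range L, g (Ψ^[M + m] x) := by
      rw [Finset.card_filter]
      push_cast
      refine Finset.sum_congr rfl fun m _ => ?_
      simp only [g, indicator_apply, Pi.one_apply]
    rw [hcard]
    set w := ∑ m ∈ Finset.range L, g (Ψ^[M + m] x)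
    -- compare with the sum of the averages
    have hshift : ∀ i ∈ Finset.range K,
        w - K ≤ ∑ m ∈ Finset.range L, g (Ψ^[i] (Ψ^[M + m] x)) := by
      intro i hi
      have hiK : (i : ℝ) ≤ K := by exact_mod_cast (Finset.mem_range.1 hi).le
      have e : ∀ m, g (Ψ^[i] (Ψ^[M + m] x)) = g (Ψ^[M + (m + i)] x) := fun m => by
        rw [← Function.iterate_add_apply]; congr 2; ring
      simp_rw [e]
      set v : ℕ → ℝ := fun m => g (Ψ^[M + m] x)
      have h1 := Finset.sum_range_add_sum_Ico v (show i ≤ L + i by omega)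
      have h2 : ∑ m ∈ Finset.range L, v (m + i) = ∑ m ∈ Finset.Ico i (L + i), v m := by
        rw [Finset.sum_Ico_eq_sum_range, Nat.add_sub_cancel]
        exact Finset.sum_congr rfl fun m _ => by rw [add_comm]
      have h3 : ∑ m ∈ Finset.range i, v m ≤ i := by
        have := Finset.sum_le_card_nsmul (Finset.range i) v 1 fun m _ => (hg01 _).2
        simpa using this
      have h4 : w ≤ ∑ m ∈ Finset.range (L + i), v m :=
        Finset.sum_le_sum_of_subset_of_nonneg (by simp) fun m _ _ => (hg01 _).1
      change _ ≤ ∑ m ∈ Finset.range L, v (m + i)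
      linarith
    have hwA : w - K ≤ ∑ m ∈ Finset.range L, A (Ψ^[M + m] x) := by
      simp_rw [hA_def]
      rw [← Finset.mul_sum, Finset.sum_comm]
      have h := Finset.card_nsmul_le_sum (Finset.range K) _ _ hshift
      rw [Finset.card_range, nsmul_eq_mul] at h
      rw [inv_mul_eq_div, le_div_iff₀ hKR]
      linarith
    have hQx : ∀ m, Q (Ψ^[m] x) = Q x := fun m => by
      by_contra h
      exact hx3 (mem_iUnion.2 ⟨m, h⟩)
    have hAQ : ∑ m ∈ Finset.range L, A (Ψ^[M + m] x) ≤ L * (ε / 4) + (M + L) * c := by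
      have h1 : ∑ m ∈ Finset.range L, A (Ψ^[M + m] x) ≤
          ∑ m ∈ Finset.range L, (ε / 4 + |A (Ψ^[M + m] x) - Q (Ψ^[M + m] x)|) := by
        refine Finset.sum_le_sum fun m _ => ?_
        have h2 := le_abs_self (A (Ψ^[M + m] x) - Q (Ψ^[M + m] x))
        have h3 : |Q x| < ε / 4 := not_le.1 hx2
        have h4 := le_abs_self (Q x)
        rw [hQx (M + m)] at h2 ⊢
        linarith
      have h2 := hE₁b x hx1 (M + L)
      rw [birkhoffSum, Finset.sum_range_add] at h2
      have h3 : 0 ≤ ∑ m ∈ Finset.range M, |A (Ψ^[m] x) - Q (Ψ^[m] x)| :=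
        Finset.sum_nonneg fun m _ => abs_nonneg _
      rw [Finset.sum_add_distrib, Finset.sum_const, Finset.card_range, nsmul_eq_mul] at h1
      push_cast at h2
      simp only [Pi.sub_apply] at h2
      linarith
    have hcL : (M + L) * c ≤ L * (ε / 4) := by
      have h1 : (M : ℝ) ≤ L * (1 / κ) := by
        rw [mul_one_div, le_div_iff₀ hκ]; linarith
      have h2 : c * (1 + 1 / κ) = ε / 4 := by
        simp only [c]; field_simp
      calc (M + L) * c ≤ (L * (1 / κ) + L) * c := by gcongr
        _ = L * (c * (1 + 1 / κ)) := by ring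
        _ = _ := by rw [h2]
    linarith

end MaximalErgodic

/-! ### From Birkhoff sums in the base to the special flow. -/

theorem circleRotation_apply (α : ℝ) (x : UnitAddCircle) :
    circleRotation α x = x + (α : UnitAddCircle) := rfl

theorem circleRotation_pow_coe (α : ℝ) (i : ℕ) (y : ℝ) :
    (circleRotation α ^ (i : ℤ)) (y : UnitAddCircle) = ((y + i * α : ℝ) : UnitAddCircle) := by
  rw [zpow_natCast]
  induction i with
  | zero => simp
  | succ i ih =>
    rw [pow_succ', Equiv.Perm.mul_apply, ih, circleRotation_apply, ← AddCircle.coe_add]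
    congr 1
    push_cast; ring

theorem dist_circleRotation_zpow (α : ℝ) (m : ℤ) (x y : UnitAddCircle) :
    dist ((circleRotation α ^ m) x) ((circleRotation α ^ m) y) = dist x y := by
  have h1 : ∀ x y, dist (circleRotation α x) (circleRotation α y) = dist x y := fun x y => by
    simp [circleRotation_apply]
  induction m with
  | zero => simp
  | succ i ih => rw [add_comm, zpow_add, zpow_one, Equiv.Perm.mul_apply, Equiv.Perm.mul_apply, h1, ih]
  | pred i ih =>
    rw [← ih, ← h1 ((circleRotation α ^ (-(i : ℤ) - 1)) x), ← Equiv.Perm.mul_apply,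
      ← Equiv.Perm.mul_apply, mul_self_zpow, sub_add_cancel]

theorem birkhoffCocycle_natCast {X : Type*} (T : Equiv.Perm X) (f : X → ℝ) (n : ℕ) (x : X) :
    birkhoffCocycle T f n x = ∑ i ∈ Finset.range n, f ((T ^ (i : ℤ)) x) := rfl

theorem birkhoffCocycle_circleRotation (α : ℝ) (f : UnitAddCircle → ℝ) (n : ℕ) (y : ℝ) :
    birkhoffCocycle (circleRotation α) f n (y : UnitAddCircle) =
      ∑ i ∈ Finset.range n, periodicLift f (y + i * α) := by
  rw [birkhoffCocycle_natCast]
  exact Finset.sum_congr rfl fun i _ => by rw [circleRotation_pow_coe]; rfl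

theorem birkhoffCocycle_mono {X : Type*} (T : Equiv.Perm X) {f : X → ℝ}
    (hf : ∃ c > 0, ∀ x, c ≤ f x) (x : X) : Monotone fun n : ℤ => birkhoffCocycle T f n x := by
  obtain ⟨c, hc, h⟩ := hf
  intro m n hmn
  have h1 := birkhoffCocycle_lower_of_le T h x hmn
  have h2 : (0 : ℝ) ≤ ((n - m : ℤ) : ℝ) := by exact_mod_cast sub_nonneg.2 hmn
  have h3 := mul_nonneg h2 hc.le
  change birkhoffCocycle T f m x ≤ birkhoffCocycle T f n x
  linarith

theorem birkhoffCocycle_natCast_le {X : Type*} (T : Equiv.Perm X) {f : X → ℝ} {K : ℝ}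
    (hK : ∀ x, f x ≤ K) (n : ℕ) (x : X) : birkhoffCocycle T f n x ≤ n * K := by
  rw [birkhoffCocycle_natCast]
  simpa using Finset.sum_le_card_nsmul (Finset.range n) _ K fun i _ => hK _

/-- Points on the same fibre lie on the same orbit of the special flow. -/
theorem exists_specialFlow_eq_of_fst_eq {X : Type*} (T : Equiv.Perm X) {f : X → ℝ}
    (hf : ∃ c > 0, ∀ x, c ≤ f x) {q q' : SpecialSpace f} (h : q.1.1 = q'.1.1) :
    ∃ t, specialFlow T f hf t q = q' := by
  refine ⟨q'.1.2 - q.1.2, Subtype.ext ?_⟩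
  have h0 := birkhoffCocycle_zero T f q.1.1
  have h1 := birkhoffCocycle_add_one T f 0 q.1.1
  have h2 := q'.2
  rw [specialFlow_val_of_mem T f hf _ q 0]
  · rw [h0, zpow_zero, Equiv.Perm.one_apply, h]
    exact Prod.ext rfl (by simp)
  · rw [h0]; linarith [h2.1]
  · rw [h1, h0, zpow_zero, Equiv.Perm.one_apply, h]; linarith [h2.2]

/-- If the Birkhoff sums at two points differ by almost `p'` at the times `m` and `m + 1`, then the
flow keeps the points close after the time shift `p'`, away from the top and the bottom. -/
theorem dist_specialFlow_lt {α : ℝ} {f : UnitAddCircle → ℝ} (hf : ∃ c > 0, ∀ x, c ≤ f x)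
    {q q' : SpecialSpace f} {η t p' : ℝ} {m : ℤ} (hqq : dist q q' < η / 2)
    (hbot : birkhoffCocycle (circleRotation α) f m q.1.1 + η < q.1.2 + t)
    (htop : q.1.2 + t + η < birkhoffCocycle (circleRotation α) f (m + 1) q.1.1)
    (hm : |birkhoffCocycle (circleRotation α) f m q'.1.1 -
      birkhoffCocycle (circleRotation α) f m q.1.1 - p'| < η / 2)
    (hm1 : |birkhoffCocycle (circleRotation α) f (m + 1) q'.1.1 -
      birkhoffCocycle (circleRotation α) f (m + 1) q.1.1 - p'| < η / 2) :
    dist (specialFlow (circleRotation α) f hf t q)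
      (specialFlow (circleRotation α) f hf (t + p') q') < η := by
  rw [SpecialSpace.dist_def] at hqq
  have hd := dist_nonneg (x := q.1.1) (y := q'.1.1)
  have hs : |q.1.2 - q'.1.2| < η / 2 := by linarith
  have hη := abs_nonneg (q.1.2 - q'.1.2)
  have hs' := abs_lt.1 hs
  have hm' := abs_lt.1 hm
  have hm1' := abs_lt.1 hm1
  rw [SpecialSpace.dist_def, specialFlow_val_of_mem _ f hf t q m (by linarith) (by linarith),
    specialFlow_val_of_mem _ f hf (t + p') q' m (by linarith) (by linarith)]
  simp only
  rw [dist_circleRotation_zpow]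
  have e : q.1.2 + t - birkhoffCocycle (circleRotation α) f m q.1.1 -
      (q'.1.2 + (t + p') - birkhoffCocycle (circleRotation α) f m q'.1.1) =
      (q.1.2 - q'.1.2) + (birkhoffCocycle (circleRotation α) f m q'.1.1 -
        birkhoffCocycle (circleRotation α) f m q.1.1 - p') := by ring
  rw [e]
  have := abs_add_le (q.1.2 - q'.1.2) (birkhoffCocycle (circleRotation α) f m q'.1.1 -
        birkhoffCocycle (circleRotation α) f m q.1.1 - p')
  linarith

/-- The skew product `(x, θ) ↦ (x + α, θ - f(x))`, which records the fibre coordinate modulo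
`γ` at the successive returns to the base. -/
def fibreSkewProduct (α γ : ℝ) (f : UnitAddCircle → ℝ) (z : UnitAddCircle × AddCircle γ) :
    UnitAddCircle × AddCircle γ :=
  (circleRotation α z.1, z.2 - (f z.1 : AddCircle γ))

theorem fibreSkewProduct_iterate (α γ : ℝ) (f : UnitAddCircle → ℝ) (n : ℕ) (x : UnitAddCircle)
    (s : ℝ) : (fibreSkewProduct α γ f)^[n] (x, (s : AddCircle γ)) =
      ((circleRotation α ^ (n : ℤ)) x,
        ((s - birkhoffCocycle (circleRotation α) f n x : ℝ) : AddCircle γ)) := by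
  induction n with
  | zero =>
    have h := birkhoffCocycle_zero (circleRotation α) f x
    simp [h]
  | succ n ih =>
    rw [Function.iterate_succ_apply', ih, fibreSkewProduct]
    refine Prod.ext ?_ ?_
    · simp only [zpow_natCast]
      rw [pow_succ', Equiv.Perm.mul_apply]
    · have h := birkhoffCocycle_add_one (circleRotation α) f n x
      push_cast
      rw [h, ← AddCircle.coe_sub, sub_sub]

/-- A rotation in the base combined with translations in the fibres, each preserving Haar measure.
-/
theorem measurePreserving_fibreSkewProduct (α γ : ℝ) [Fact (0 < γ)] {f : UnitAddCircle → ℝ}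
    (hf : Measurable f) :
    MeasurePreserving (fibreSkewProduct α γ f)
      ((volume : Measure UnitAddCircle).prod AddCircle.haarAddCircle)
      ((volume : Measure UnitAddCircle).prod AddCircle.haarAddCircle) := by
  have h1 : MeasurePreserving (circleRotation α) (volume : Measure UnitAddCircle) volume :=
    measurePreserving_add_right volume (α : UnitAddCircle)
  refine h1.skew_product (g := fun x θ => θ - (f x : AddCircle γ)) ?_ (Eventually.of_forall fun x => ?_)
  · exact measurable_snd.sub (AddCircle.measurable_mk'.comp (hf.comp measurable_fst))
  · exact (measurePreserving_sub_right AddCircle.haarAddCircle (f x : AddCircle γ)).map_eq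

/-- The points whose fibre coordinate is `η`-close to `γℤ`. -/
def nearZero (γ η : ℝ) : Set (UnitAddCircle × AddCircle γ) :=
  univ ×ˢ Metric.closedBall 0 η

theorem measurableSet_nearZero (γ η : ℝ) : MeasurableSet (nearZero γ η) :=
  MeasurableSet.univ.prod Metric.isClosed_closedBall.measurableSet

theorem measureReal_nearZero_le {γ : ℝ} [hγ : Fact (0 < γ)] {η : ℝ} (hη : 0 ≤ η) :
    ((volume : Measure UnitAddCircle).prod (AddCircle.haarAddCircle (T := γ))).real
      (nearZero γ η) ≤ 2 * η / γ := by
  have h1 := AddCircle.volume_closedBall γ (x := 0) η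
  rw [AddCircle.volume_eq_smul_haarAddCircle, Measure.smul_apply, smul_eq_mul] at h1
  have h2 : γ * (AddCircle.haarAddCircle (T := γ)).real (Metric.closedBall 0 η) =
      min γ (2 * η) := by
    have := congrArg ENNReal.toReal h1
    rwa [ENNReal.toReal_mul, ENNReal.toReal_ofReal hγ.out.le,
      ENNReal.toReal_ofReal (le_min hγ.out.le (by positivity))] at this
  rw [nearZero, measureReal_prod_prod, measureReal_def, UnitAddCircle.measure_univ,
    ENNReal.toReal_one, one_mul, le_div_iff₀ hγ.out, mul_comm, h2]
  exact min_le_right _ _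

theorem coe_mem_nearZero {γ η r : ℝ} {x : UnitAddCircle} {n : ℤ} (h : |r + n * γ| ≤ η) :
    (x, (r : AddCircle γ)) ∈ nearZero γ η := by
  refine ⟨mem_univ _, ?_⟩
  rw [mem_closedBall_zero_iff]
  have e : (r : AddCircle γ) = ((r + n * γ : ℝ) : AddCircle γ) := by
    rw [AddCircle.coe_add]
    have : ((n * γ : ℝ) : AddCircle γ) = 0 := by
      rw [AddCircle.coe_eq_zero_iff]; exact ⟨n, by simp⟩
    rw [this, add_zero]
  rw [e]
  exact QuotientAddGroup.norm_mk_le_norm.trans h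

open Classical in
/-- The number of integer times at which two orbits are close, in terms of a window in the base. -/
theorem le_ncard_close {α γ : ℝ} (hγ : 0 < γ) {f : UnitAddCircle → ℝ}
    (hf : ∃ c > 0, ∀ x, c ≤ f x) {q q' : SpecialSpace f} {ε η p' ρ : ℝ} (hηε : η ≤ ε) (hηγ : 2 * η < γ)
    (hqq : dist q q' < η / 2) {M L : ℕ}
    (hclose : ∀ n : ℕ, M ≤ n → n ≤ M + L →
      |birkhoffCocycle (circleRotation α) f n q'.1.1 -
        birkhoffCocycle (circleRotation α) f n q.1.1 - p'| < η / 2)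
    (hvisit : (((Finset.range (L + 1)).filter fun m =>
      (fibreSkewProduct α γ f)^[M + m] (q.1.1, (q.1.2 : AddCircle γ)) ∈ nearZero γ η).card : ℝ) ≤ ρ)
    {M' L' : ℝ} (hM' : M' = (birkhoffCocycle (circleRotation α) f M q.1.1 - q.1.2) / γ)
    (hL' : L' = (birkhoffCocycle (circleRotation α) f (M + L : ℕ) q.1.1 -
      birkhoffCocycle (circleRotation α) f M q.1.1) / γ) :
    L' - 1 - ρ ≤ ({n : ℤ | M' ≤ n ∧ n ≤ M' + L' ∧
      dist (specialFlow (circleRotation α) f hf (n * γ) q)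
        (specialFlow (circleRotation α) f hf (n * γ + p') q') < ε}.ncard : ℝ) := by
  set x := q.1.1
  set s := q.1.2
  set S : ℤ → ℝ := fun n => birkhoffCocycle (circleRotation α) f n x with hSdef
  have hSmono : Monotone S := birkhoffCocycle_mono (circleRotation α) hf x
  set good : ℤ → Prop := fun n => dist (specialFlow (circleRotation α) f hf (n * γ) q)
        (specialFlow (circleRotation α) f hf (n * γ + p') q') < ε
  have hML : M' + L' = (S (M + L : ℕ) - s) / γ := by
    rw [hM', hL', ← add_div]; congr 1; simp only [S]; ring
  -- Half-open on the right, so that the return index m at time nγ satisfies m < M + L and m + 1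
  -- stays in the window.
  set I := Finset.Ico ⌈M'⌉ ⌈M' + L'⌉
  have hmemI : ∀ n ∈ I, S M ≤ s + n * γ ∧ s + n * γ < S (M + L : ℕ) := by
    intro n hn
    obtain ⟨h1, h2⟩ := Finset.mem_Ico.1 hn
    have h1' := Int.ceil_le.1 h1
    have h2' := Int.lt_ceil.1 h2
    rw [hML, lt_div_iff₀ hγ] at h2'
    rw [hM', div_le_iff₀ hγ] at h1'
    change birkhoffCocycle (circleRotation α) f M x ≤ _ ∧ _
    constructor <;> linarith
  -- A bad time must be η-close to the return time m or m + 1; otherwise `dist_specialFlow_lt`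
  -- applies. The index m + 1 may equal M + L, hence `L + 1`.
  have hbad : ∀ n ∈ I, ¬ good n → ∃ j ∈ Finset.range (L + 1),
      |s - S (M + j : ℕ) + n * γ| ≤ η := by
    intro n hn hng
    obtain ⟨hn1, hn2⟩ := hmemI n hn
    obtain ⟨m, ⟨hm1, hm2⟩, -⟩ := existsUnique_birkhoffCocycle (circleRotation α) hf x (s + n * γ)
    change S m ≤ _ at hm1
    change _ < S (m + 1) at hm2
    have hmM : (M : ℤ) ≤ m := by
      by_contra! hlt
      have := hSmono (show m + 1 ≤ (M : ℤ) by omega)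
      linarith
    have hmL : m < (M + L : ℕ) := by
      by_contra! hle
      have := hSmono hle
      linarith
    obtain ⟨j, rfl⟩ := Int.le.dest hmM
    have hjL : j < L := by push_cast at hmL; omega
    by_contra! hno
    have h1 := hno j (Finset.mem_range.2 (by omega))
    have h2 := hno (j + 1) (Finset.mem_range.2 (by omega))
    have e1 : ((M + j : ℕ) : ℤ) = M + j := by push_cast; ring
    have e2 : ((M + (j + 1) : ℕ) : ℤ) = M + j + 1 := by push_cast; ring
    rw [e1] at h1
    rw [e2] at h2
    rw [abs_of_nonneg (by linarith)] at h1
    rw [abs_of_nonpos (by linarith)] at h2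
    have h3 := hclose (M + j) (by omega) (by omega)
    have h4 := hclose (M + (j + 1)) (by omega) (by omega)
    rw [e1] at h3
    rw [e2] at h4
    refine hng (lt_of_lt_of_le (dist_specialFlow_lt hf hqq (m := M + j)
      (by change S (M + j) + η < s + n * γ; linarith)
      (by change s + n * γ + η < S (M + j + 1); linarith) h3 h4) hηε)
  choose! j hj1 hj2 using hbad
  -- Distinct bad times give distinct visits: two values nγ within η of the same number differ by at
  -- most 2η < γ.
  have hcardbad : ((I.filter fun n => ¬ good n).card : ℝ) ≤ ρ := by
    refine le_trans ?_ hvisit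
    exact_mod_cast Finset.card_le_card_of_injOn j (fun n hn => by
      obtain ⟨hnI, hng⟩ := Finset.mem_filter.1 hn
      refine Finset.mem_coe.2 (Finset.mem_filter.2 ⟨hj1 n hnI hng, ?_⟩)
      rw [fibreSkewProduct_iterate]
      exact coe_mem_nearZero (hj2 n hnI hng)) (fun n hn n' hn' hnn => by
      obtain ⟨hnI, hng⟩ := Finset.mem_filter.1 hn
      obtain ⟨hnI', hng'⟩ := Finset.mem_filter.1 hn'
      have h1 := abs_le.1 (hj2 n hnI hng)
      have h2 := abs_le.1 (hj2 n' hnI' hng')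
      rw [hnn] at h1
      have h3 : |((n - n' : ℤ) : ℝ)| * γ < 1 * γ := by
        rw [← abs_of_pos hγ, ← abs_mul, abs_of_pos hγ, one_mul]
        push_cast
        rw [abs_lt]
        constructor <;> linarith
      have h4 : |((n - n' : ℤ) : ℝ)| < 1 := lt_of_mul_lt_mul_right h3 hγ.le
      have h5 : |n - n'| < 1 := by exact_mod_cast h4
      have h6 := Int.abs_lt_one_iff.1 h5
      omega)
  have hcardI : L' - 1 ≤ I.card := by
    rw [Int.card_Ico]
    have h1 : ((⌈M' + L'⌉ - ⌈M'⌉ : ℤ) : ℝ) ≤ ((⌈M' + L'⌉ - ⌈M'⌉).toNat : ℝ) := by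
      exact_mod_cast Int.self_le_toNat _
    have h2 := Int.le_ceil (M' + L')
    have h3 := Int.ceil_lt_add_one M'
    push_cast at h1
    linarith
  have hsum := Finset.card_filter_add_card_filter_not (s := I) good
  have hsum' : ((I.filter good).card : ℝ) + (I.filter fun n => ¬ good n).card = I.card := by
    exact_mod_cast hsum
  have hfin : {n : ℤ | M' ≤ n ∧ n ≤ M' + L' ∧ good n}.Finite :=
    (Set.finite_Icc ⌈M'⌉ ⌊M' + L'⌋).subset fun n hn =>
      ⟨Int.ceil_le.2 hn.1, Int.le_floor.2 hn.2.1⟩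
  have hle : (I.filter good).card ≤ {n : ℤ | M' ≤ n ∧ n ≤ M' + L' ∧ good n}.ncard := by
    rw [← Set.ncard_coe_finset]
    refine Set.ncard_le_ncard (fun n hn => ?_) hfin
    obtain ⟨hnI, hng⟩ := Finset.mem_filter.1 hn
    obtain ⟨h1, h2⟩ := Finset.mem_Ico.1 hnI
    exact ⟨Int.ceil_le.1 h1, (Int.lt_ceil.1 h2).le, hng⟩
  have hle' : ((I.filter good).card : ℝ) ≤
      ({n : ℤ | M' ≤ n ∧ n ≤ M' + L' ∧ good n}.ncard : ℝ) := by exact_mod_cast hle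
  change _ ≤ ({n : ℤ | M' ≤ n ∧ n ≤ M' + L' ∧ good n}.ncard : ℝ)
  linarith

/-! ### Frozen drift for pairs of points of the circle. -/

/-- The points of the circle whose forward orbit meets the discontinuities. -/
def singularOrbits (α : ℝ) {k : ℕ} (β : Fin (k + 1) → ℝ) : Set UnitAddCircle :=
  (fun t : ℝ => (t : UnitAddCircle)) '' ⋃ i : ℕ, (fun t => t - i * α) '' singularSet β

theorem countable_singularOrbits (α : ℝ) {k : ℕ} (β : Fin (k + 1) → ℝ) :
    (singularOrbits α β).Countable :=
  (countable_iUnion fun _ => (countable_singularSet β).image _).image _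

theorem add_notMem_singularSet {α : ℝ} {k : ℕ} {β : Fin (k + 1) → ℝ} {y : ℝ}
    (hy : (y : UnitAddCircle) ∉ singularOrbits α β) (i : ℕ) : y + i * α ∉ singularSet β :=
  fun h => hy ⟨y, mem_iUnion.2 ⟨i, y + i * α, h, by ring⟩, rfl⟩

theorem volume_eq_zero_of_countable {s : Set UnitAddCircle} (hs : s.Countable) :
    volume s = 0 := by
  rw [← biUnion_of_singleton s, measure_biUnion_null_iff hs]
  intro x _
  have h := AddCircle.volume_closedBall (1 : ℝ) (x := x) 0
  rwa [Metric.closedBall_zero, mul_zero, min_eq_right zero_le_one, ENNReal.ofReal_zero] at h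

/-- The drift of the Birkhoff sums of two nearby points of the circle. -/
theorem exists_circle_window {α : ℝ} (hα : Irrational α) (hb : BddAbove (partialQuotients α))
    {f : UnitAddCircle → ℝ} {k : ℕ} {β : Fin (k + 1) → ℝ}
    (hβ : IsPiecewiseAbsolutelyContinuous f β) {p : ℝ} (hp0 : 0 < p)
    (hpS : p < |sumOfJumps f β|) {ε : ℝ} (hε : 0 < ε) :
    ∃ κ > (0 : ℝ), ∀ N : ℕ, ∃ δ > (0 : ℝ), ∀ x x' : UnitAddCircle, x ≠ x' → dist x x' < δ →
      x ∉ singularOrbits α β → x' ∉ singularOrbits α β →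
      ∃ M L : ℕ, N ≤ M ∧ N ≤ L ∧ κ * M ≤ L ∧
        ∃ p' ∈ (fun d => Real.sign (sumOfJumps f β) * p - d) '' jumpSums α f β ∪
          (fun d => -(Real.sign (sumOfJumps f β) * p) + d) '' jumpSums α f β,
        ∀ n : ℕ, M ≤ n → n ≤ M + L →
          |birkhoffCocycle (circleRotation α) f n x' -
            birkhoffCocycle (circleRotation α) f n x - p'| < ε := by
  obtain ⟨κ, hκ, H⟩ := exists_window hα hb hβ hp0 hpS hε
  refine ⟨κ, hκ, fun N => ?_⟩
  obtain ⟨δ, hδ, H⟩ := H N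
  refine ⟨δ, hδ, fun x x' hne hd hx hx' => ?_⟩
  obtain ⟨y, rfl⟩ := QuotientAddGroup.mk_surjective x
  obtain ⟨b, hb⟩ := QuotientAddGroup.mk_surjective (x' - (y : UnitAddCircle))
  change (b : UnitAddCircle) = x' - (y : UnitAddCircle) at hb
  obtain ⟨a, ha, hax⟩ : ∃ a : ℝ, |a| < δ ∧ x' = ((y + a : ℝ) : UnitAddCircle) := by
    -- The representative whose absolute value is the distance on the circle.
    refine ⟨b - round b, ?_, ?_⟩
    · rw [← UnitAddCircle.norm_eq, hb, ← dist_eq_norm, dist_comm]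
      exact hd
    · have h0 : ((round b : ℝ) : UnitAddCircle) = 0 :=
        (AddCircle.coe_eq_zero_iff (1 : ℝ)).2 ⟨round b, by simp⟩
      rw [AddCircle.coe_add, AddCircle.coe_sub, h0, sub_zero, hb]
      abel
  subst hax
  simp_rw [birkhoffCocycle_circleRotation]
  rcases lt_trichotomy a 0 with h | h | h
  -- Here x lies to the right of x', so the window is taken from x' with step -a. The difference
  -- changes sign, which produces the second half of `P`.
  · rw [abs_of_neg h] at ha
    have e : y + a + -a = y := by ring
    obtain ⟨M, L, hM, hL, hML, d, hd, hw⟩ := H (y + a) (-a) (by linarith) ha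
      (add_notMem_singularSet hx') (by rw [e]; exact add_notMem_singularSet hx)
    refine ⟨M, L, hM, hL, hML, _, Or.inr ⟨d, hd, rfl⟩, fun n h1 h2 => ?_⟩
    have := hw n h1 h2
    rw [e] at this
    rw [← abs_neg]
    convert this using 2
    ring
  · subst h
    exact absurd (by simp) hne
  · rw [abs_of_pos h] at ha
    obtain ⟨M, L, hM, hL, hML, d, hd, hw⟩ := H y a h ha
      (add_notMem_singularSet hx) (add_notMem_singularSet hx')
    exact ⟨M, L, hM, hL, hML, _, Or.inl ⟨d, hd, rfl⟩, hw⟩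

/-! ### Measure of sets described by the fibre coordinate modulo γ. -/

section Measure

variable {X : Type*} [MeasurableSpace X] {μ : Measure X} {f : X → ℝ}

theorem measurableSet_specialSpace (hf : Measurable f) :
    MeasurableSet {q : X × ℝ | 0 ≤ q.2 ∧ q.2 < f q.1} :=
  (measurableSet_le measurable_const measurable_snd).inter
    (measurableSet_lt measurable_snd (hf.comp measurable_fst))

theorem specialMeasure_preimage (hf : Measurable f) {A : Set (X × ℝ)} :
    specialMeasure μ f {q | q.1 ∈ A} =
      (μ.prod volume) (A ∩ {q : X × ℝ | 0 ≤ q.2 ∧ q.2 < f q.1}) := by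
  have h := (MeasurableEmbedding.subtype_coe (measurableSet_specialSpace hf)).comap_apply
    (μ.prod (volume : Measure ℝ)) (Subtype.val ⁻¹' A)
  refine h.trans ?_
  rw [Subtype.image_preimage_coe, inter_comm]

theorem specialMeasure_univ_ge [IsProbabilityMeasure μ] (hf : Measurable f) {c : ℝ}
    (hc : ∀ x, c ≤ f x) : ENNReal.ofReal c ≤ specialMeasure μ f univ := by
  refine le_of_le_of_eq ?_ (specialMeasure_preimage (A := univ) hf).symm
  rw [univ_inter]
  calc ENNReal.ofReal c = (μ.prod volume) (univ ×ˢ Ico 0 c) := by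
        rw [Measure.prod_prod, measure_univ, one_mul, Real.volume_Ico, sub_zero]
    _ ≤ (μ.prod volume) {q : X × ℝ | 0 ≤ q.2 ∧ q.2 < f q.1} :=
        measure_mono fun q hq => ⟨hq.2.1, hq.2.2.trans_le (hc _)⟩

theorem specialMeasure_univ_le [IsProbabilityMeasure μ] (hf : Measurable f) {K : ℝ}
    (hK : ∀ x, f x ≤ K) : specialMeasure μ f univ ≤ ENNReal.ofReal K := by
  refine le_of_eq_of_le (specialMeasure_preimage (A := univ) hf) ?_
  rw [univ_inter]
  calc _ ≤ (μ.prod volume) (univ ×ˢ Ico 0 K) :=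
        measure_mono fun q hq => ⟨mem_univ _, hq.1, hq.2.trans_le (hK _)⟩
    _ = ENNReal.ofReal K := by
        rw [Measure.prod_prod, measure_univ, one_mul, Real.volume_Ico, sub_zero]

/-- The measure of a set of points of the special space defined through the fibre coordinate
modulo `γ`. -/
theorem specialMeasure_mod_le [IsProbabilityMeasure μ] (hf : Measurable f) {γ : ℝ}
    [hγ : Fact (0 < γ)] {J : ℕ} (hJ : ∀ x, f x ≤ J * γ) {E : Set (X × AddCircle γ)}
    (hE : MeasurableSet E) :
    specialMeasure μ f {q : SpecialSpace f | (q.1.1, (q.1.2 : AddCircle γ)) ∈ E} ≤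
      (J + 1) * (ENNReal.ofReal γ * (μ.prod (AddCircle.haarAddCircle (T := γ))) E) := by
  set φ : X × ℝ → X × AddCircle γ := Prod.map id fun s : ℝ => (s : AddCircle γ)
  have hφ : Measurable φ := measurable_id.prodMap AddCircle.measurable_mk'
  refine le_of_eq_of_le (specialMeasure_preimage (A := φ ⁻¹' E) hf) ?_
  have hpiece : ∀ t : ℝ, (μ.prod volume) (φ ⁻¹' E ∩ univ ×ˢ Ioc t (t + γ)) =
      ENNReal.ofReal γ * (μ.prod (AddCircle.haarAddCircle (T := γ))) E := by
    intro t
    have hmp : MeasurePreserving φ (μ.prod (volume.restrict (Ioc t (t + γ))))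
        (μ.prod (volume : Measure (AddCircle γ))) :=
      (MeasurePreserving.id μ).prod (AddCircle.measurePreserving_mk γ t)
    have h := hmp.measure_preimage hE.nullMeasurableSet
    rw [AddCircle.volume_eq_smul_haarAddCircle, Measure.prod_smul_right, Measure.smul_apply,
      smul_eq_mul] at h
    rw [← h, ← Measure.restrict_apply (hφ hE), ← Measure.prod_restrict, Measure.restrict_univ]
  -- The strips are half-open on the left, so the one with i = 0 is needed only for the points with
  -- s = 0; hence J + 1 strips.
  have hsub : φ ⁻¹' E ∩ {q : X × ℝ | 0 ≤ q.2 ∧ q.2 < f q.1} ⊆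
      ⋃ i ∈ Finset.range (J + 1), φ ⁻¹' E ∩ univ ×ˢ Ioc (((i : ℝ) - 1) * γ)
        (((i : ℝ) - 1) * γ + γ) := by
    rintro q ⟨hqE, hq0, hqf⟩
    have hdiv : q.2 / γ < J := by
      rw [div_lt_iff₀ hγ.out]; exact hqf.trans_le (hJ _)
    have h1 := Nat.le_ceil (q.2 / γ)
    have h2 := Nat.ceil_lt_add_one (div_nonneg hq0 hγ.out.le)
    rw [div_le_iff₀ hγ.out] at h1
    rw [← sub_lt_iff_lt_add, lt_div_iff₀ hγ.out] at h2
    simp only [mem_iUnion]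
    refine ⟨⌈q.2 / γ⌉₊, Finset.mem_range.2 ?_, hqE, mem_univ _, h2, by linarith⟩
    exact Nat.lt_succ_of_le (Nat.ceil_le.2 hdiv.le)
  refine (measure_mono hsub).trans ((measure_biUnion_finset_le _ _).trans ?_)
  simp_rw [hpiece]
  simp

end Measure

/-- The measure of the set of points of the special space whose base point avoids a countable set
and whose fibre coordinate modulo `γ` is controlled. -/
theorem normalizedSpecialMeasure_compl_le {f : UnitAddCircle → ℝ} (hf : Measurable f) {c K : ℝ}
    (hc : 0 < c) (hcf : ∀ x, c ≤ f x) (hK : ∀ x, f x ≤ K) {γ : ℝ} [hγ : Fact (0 < γ)] {J : ℕ}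
    (hJ : ∀ x, f x ≤ J * γ) {G : Set (UnitAddCircle × AddCircle γ)} (hG : MeasurableSet G) {σ : ℝ}
    (hGσ : ((volume : Measure UnitAddCircle).prod (AddCircle.haarAddCircle (T := γ))).real Gᶜ ≤ σ)
    {C : Set UnitAddCircle} (hC : C.Countable) :
    1 - (J + 1) * γ * σ / c ≤ (normalizedSpecialMeasure volume f).real
      ({q | (q.1.1, (q.1.2 : AddCircle γ)) ∈ G} ∩ {q | q.1.1 ∉ C}) := by
  have : IsProbabilityMeasure (volume : Measure UnitAddCircle) := ⟨UnitAddCircle.measure_univ⟩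
  have hσ : 0 ≤ σ := measureReal_nonneg.trans hGσ
  have hγ0 := hγ.out
  set Z₁ : Set (SpecialSpace f) := {q | (q.1.1, (q.1.2 : AddCircle γ)) ∈ G}
  set Z₂ : Set (SpecialSpace f) := {q | q.1.1 ∉ C}
  have hval : Measurable fun q : SpecialSpace f => q.1 := measurable_subtype_coe
  have hZ₁m : MeasurableSet Z₁ :=
    ((measurable_fst.comp hval).prodMk (AddCircle.measurable_mk'.comp
      (measurable_snd.comp hval))) hG
  have hZ₂m : MeasurableSet Z₂ := (measurable_fst.comp hval) hC.measurableSet.compl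
  set m₀ := specialMeasure volume f
  have hm1 : ENNReal.ofReal c ≤ m₀ univ := specialMeasure_univ_ge hf hcf
  have hm2 : m₀ univ ≤ ENNReal.ofReal K := specialMeasure_univ_le hf hK
  have hm0 : m₀ univ ≠ 0 := (lt_of_lt_of_le (ENNReal.ofReal_pos.2 hc) hm1).ne'
  have hmt : m₀ univ ≠ ⊤ := ne_top_of_le_ne_top ENNReal.ofReal_ne_top hm2
  have hprob : IsProbabilityMeasure (normalizedSpecialMeasure volume f) :=
    ⟨by rw [normalizedSpecialMeasure, Measure.smul_apply, smul_eq_mul,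
      ENNReal.inv_mul_cancel hm0 hmt]⟩
  set τ := (J + 1) * γ * σ / c
  have hτ : 0 ≤ τ := by positivity
  have h1 : m₀ Z₁ᶜ ≤ ENNReal.ofReal (τ * c) := by
    refine (specialMeasure_mod_le (μ := volume) hf hJ hG.compl).trans ?_
    have hGc : ((volume : Measure UnitAddCircle).prod
        (AddCircle.haarAddCircle (T := γ))) Gᶜ ≤ ENNReal.ofReal σ := by
      rw [← ofReal_measureReal]
      exact ENNReal.ofReal_le_ofReal hGσ
    calc ((J : ENNReal) + 1) * (ENNReal.ofReal γ * ((volume : Measure UnitAddCircle).prod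
        (AddCircle.haarAddCircle (T := γ))) Gᶜ)
        ≤ ENNReal.ofReal (J + 1) * (ENNReal.ofReal γ * ENNReal.ofReal σ) := by
          rw [ENNReal.ofReal_add (Nat.cast_nonneg _) zero_le_one, ENNReal.ofReal_natCast,
            ENNReal.ofReal_one]
          gcongr
      _ = ENNReal.ofReal (τ * c) := by
          rw [← ENNReal.ofReal_mul hγ0.le, ← ENNReal.ofReal_mul (by positivity)]
          congr 1
          simp only [τ]
          field_simp
  have h2 : m₀ Z₂ᶜ = 0 := by
    have e : Z₂ᶜ = {q | q.1 ∈ C ×ˢ (univ : Set ℝ)} := by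
      ext q; simp [Z₂]
    rw [e]
    refine (specialMeasure_preimage hf).trans (measure_mono_null inter_subset_left ?_)
    rw [Measure.prod_prod, volume_eq_zero_of_countable hC, zero_mul]
  have h3 : m₀ (Z₁ ∩ Z₂)ᶜ ≤ ENNReal.ofReal (τ * c) := by
    rw [compl_inter]
    exact (measure_union_le _ _).trans (by rw [h2, add_zero]; exact h1)
  -- The total mass is at least c, so normalization costs at most a factor 1/c.
  have h4 : (normalizedSpecialMeasure volume f) (Z₁ ∩ Z₂)ᶜ ≤ ENNReal.ofReal τ := by
    rw [normalizedSpecialMeasure, Measure.smul_apply, smul_eq_mul, mul_comm, ← div_eq_mul_inv]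
    refine ENNReal.div_le_of_le_mul (h3.trans ?_)
    rw [ENNReal.ofReal_mul hτ]
    gcongr
  have h5 : (normalizedSpecialMeasure volume f).real (Z₁ ∩ Z₂)ᶜ ≤ τ :=
    ENNReal.toReal_le_of_le_ofReal hτ h4
  rw [probReal_compl_eq_one_sub (hZ₁m.inter hZ₂m)] at h5
  linarith

end

/-! ### Choice of the constants and conclusion. -/

theorem mainTheorem2 (α : ℝ) (hα : Irrational α) (hbdd : BddAbove (partialQuotients α))
    (f : UnitAddCircle → ℝ) (hf : ∃ c > 0, ∀ x, c ≤ f x)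
    (k : ℕ) (β : Fin (k + 1) → ℝ) (hβ : IsPiecewiseAbsolutelyContinuous f β)
    (hS : sumOfJumps f β ≠ 0)
    (p : ℝ) (hp0 : 0 < p) (hpS : p < |sumOfJumps f β|)
    (hpD : p ∉ jumpSums α f β) (hpD' : -p ∉ jumpSums α f β)
    (γ : ℝ) (hγ : 0 < γ) :
    RatnerProperty (specialFlow (circleRotation α) f hf)
      (normalizedSpecialMeasure volume f) γ
      ((fun d => Real.sign (sumOfJumps f β) * p - d) '' jumpSums α f β ∪
        (fun d => -(Real.sign (sumOfJumps f β) * p) + d) '' jumpSums α f β) := by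
  have hfin := finite_jumpSums α f β
  refine ⟨hγ.ne', (hfin.image _).union (hfin.image _), ?_, fun ε hε => ?_⟩
  · have key : Real.sign (sumOfJumps f β) * p ∉ jumpSums α f β := by
      rcases lt_or_gt_of_ne hS with h | h
      · rwa [Real.sign_of_neg h, neg_one_mul]
      · rwa [Real.sign_of_pos h, one_mul]
    rintro (⟨d, hd, h⟩ | ⟨d, hd, h⟩)
    · exact key ((sub_eq_zero.1 h) ▸ hd)
    · exact key ((neg_add_eq_zero.1 h) ▸ hd)
  have : Fact (0 < γ) := ⟨hγ⟩
  have : IsProbabilityMeasure (volume : Measure UnitAddCircle) := ⟨UnitAddCircle.measure_univ⟩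
  have hfm : Measurable f := hβ.measurable
  obtain ⟨c, hc, hcf⟩ := id hf
  obtain ⟨K, hK⟩ := hβ.bounded_above
  have hcK : c ≤ K := (hcf 0).trans (hK 0)
  have hK0 : 0 < K := hc.trans_le hcK
  -- the constants
  obtain ⟨J, hJ⟩ := exists_nat_ge (K / γ)
  rw [div_le_iff₀ hγ] at hJ
  -- Chosen so that an exceptional set of measure σ for the skew product has normalized measure at
  -- most ε / 2 in the special space.
  set σ := ε * c / (2 * (J + 1) * γ)
  have hσ : 0 < σ := by positivity
  -- The admissible frequency of bad visits per base step: L base steps span at least Lc/γ units of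
  -- γ, so εL' ≥ 4ρL, which leaves room for ρ(L + 1) + 1.
  set ρ := ε * c / (4 * γ)
  have hρ : 0 < ρ := by positivity
  -- The last term makes the strip small enough for the visit bound. Nothing here depends on `N`, so
  -- neither does the κ obtained from η.
  set η := min (ε / 2) (min (γ / 4) (γ * (ρ * σ / 8) / 2))
  have hη : 0 < η := by positivity
  have hηε : η < ε := (min_le_left _ _).trans_lt (half_lt_self hε)
  have hηγ : 2 * η < γ := by
    have : η ≤ γ / 4 := (min_le_right _ _).trans (min_le_left _ _)
    linarith
  have hηρ : 2 * η / γ ≤ ρ * σ / 8 := by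
    have : η ≤ γ * (ρ * σ / 8) / 2 := (min_le_right _ _).trans (min_le_right _ _)
    rw [div_le_iff₀ hγ]
    linarith
  obtain ⟨κ, hκ, hwin⟩ := exists_circle_window hα hbdd hβ hp0 hpS (half_pos hη)
  obtain ⟨N₀, G, hGm, hG, hvisit⟩ := exists_visit_frequency_bound
    (measurePreserving_fibreSkewProduct α γ hfm) (measurableSet_nearZero γ η) hρ hκ hσ
    ((measureReal_nearZero_le hη.le).trans hηρ)
  -- Passing from base steps to flow time uses L' ≥ Lc/γ and M' ≤ MK/γ.
  refine ⟨κ * c / K, by positivity, fun N => ?_⟩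
  -- lower bounds for the base window
  obtain ⟨N₁, hN₁⟩ := exists_nat_ge ((N * γ + K + γ) / c + 4 * γ / (ε * c) + N * γ / c)
  obtain ⟨δ₀, hδ₀, hwin⟩ := hwin (max N₀ (N₁ + 1))
  set Z₁ : Set (SpecialSpace f) := {q | (q.1.1, (q.1.2 : AddCircle γ)) ∈ G}
  set Z₂ : Set (SpecialSpace f) := {q | q.1.1 ∉ singularOrbits α β}
  have hval : Measurable fun q : SpecialSpace f => q.1 := measurable_subtype_coe
  have hZ₁m : MeasurableSet Z₁ :=
    ((measurable_fst.comp hval).prodMk (AddCircle.measurable_mk'.comp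
      (measurable_snd.comp hval))) hGm
  have hCm := (countable_singularOrbits α β).measurableSet
  have hZ₂m : MeasurableSet Z₂ := (measurable_fst.comp hval) hCm.compl
  refine ⟨min δ₀ (η / 2), lt_min hδ₀ (half_pos hη), Z₁ ∩ Z₂, hZ₁m.inter hZ₂m, ?_, ?_⟩
  · have h := normalizedSpecialMeasure_compl_le (γ := γ) hfm hc hcf hK (fun x => (hK x).trans hJ)
      hGm hG (countable_singularOrbits α β)
    have e : (J + 1) * γ * σ / c = ε / 2 := by simp only [σ]; field_simp
    rw [e] at h
    linarith
  · rintro q ⟨hq1, hq2⟩ q' ⟨-, hq2'⟩ horb hd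
    have hne : q.1.1 ≠ q'.1.1 := fun h => by
      obtain ⟨t, ht⟩ := exists_specialFlow_eq_of_fst_eq (circleRotation α) hf h
      exact horb t ht
    have hdx : dist q.1.1 q'.1.1 < δ₀ := by
      have := hd.trans_le (min_le_left _ _)
      rw [SpecialSpace.dist_def] at this
      linarith [abs_nonneg (q.1.2 - q'.1.2)]
    obtain ⟨M, L, hM, hL, hML, p', hp', hclose⟩ := hwin q.1.1 q'.1.1 hne hdx hq2 hq2'
    have hv := hvisit _ hq1 M (L + 1) (((le_max_left _ _).trans hL).trans (Nat.le_succ L))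
      (by push_cast; linarith)
    have hcount := le_ncard_close hγ hf hηε.le hηγ (hd.trans_le (min_le_right _ _)) hclose
      hv rfl rfl
    set S := birkhoffCocycle (circleRotation α) f
    set M' := (S M q.1.1 - q.1.2) / γ
    set L' := (S (M + L : ℕ) q.1.1 - S M q.1.1) / γ
    have hMN : (N₁ : ℝ) + 1 ≤ M := by exact_mod_cast (le_max_right _ _).trans hM
    have hLN : (N₁ : ℝ) + 1 ≤ L := by exact_mod_cast (le_max_right _ _).trans hL
    have hq0 := q.2.1
    have hqK : q.1.2 < K := q.2.2.trans_le (hK _)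
    have hSM : M * c ≤ S M q.1.1 := by
      have := birkhoffCocycle_lower (circleRotation α) hcf q.1.1 0 M
      rwa [birkhoffCocycle_zero, zero_add, zero_add] at this
    have hSM' : S M q.1.1 ≤ M * K := birkhoffCocycle_natCast_le _ hK M q.1.1
    have hSL : L * c ≤ S (M + L : ℕ) q.1.1 - S M q.1.1 := by
      have := birkhoffCocycle_lower (circleRotation α) hcf q.1.1 M L
      push_cast
      change S M q.1.1 + L * c ≤ S (M + L) q.1.1 at this
      linarith
    have hb1 : (N * γ + K + γ) / c ≤ N₁ := by
      have h1 : 0 ≤ 4 * γ / (ε * c) := by positivity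
      have h2 : 0 ≤ N * γ / c := by positivity
      linarith
    have hb2 : 4 * γ / (ε * c) ≤ N₁ := by
      have h1 : 0 ≤ (N * γ + K + γ) / c := by positivity
      have h2 : 0 ≤ N * γ / c := by positivity
      linarith
    rw [div_le_iff₀ hc] at hb1
    rw [div_le_iff₀ (by positivity)] at hb2
    have hM'N : N + 1 ≤ M' := by
      rw [le_div_iff₀ hγ]
      nlinarith
    have hL'c : L * c / γ ≤ L' := by
      simp only [L']; gcongr
    have hL'N : N ≤ L' := by
      refine le_trans ?_ hL'c
      rw [le_div_iff₀ hγ]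
      nlinarith
    have hM'0 : 0 < M' := by
      have : (0 : ℝ) ≤ N := Nat.cast_nonneg N
      linarith
    have hL0 : (1 : ℝ) ≤ L := by linarith [(Nat.cast_nonneg N₁ : (0 : ℝ) ≤ N₁)]
    have hL'0 : 0 < L' := lt_of_lt_of_le (by positivity) hL'c
    refine ⟨M', L', by linarith, hL'N, ?_, p', hp', ?_⟩
    · rw [le_div_iff₀ hM'0]
      refine le_trans ?_ hL'c
      have h1 : M' ≤ M * K / γ := by
        simp only [M']; gcongr; linarith
      calc κ * c / K * M' ≤ κ * c / K * (M * K / γ) := by gcongr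
        _ = (κ * M) * c / γ := by field_simp
        _ ≤ L * c / γ := by gcongr
    · rw [lt_div_iff₀ hL'0]
      refine lt_of_lt_of_le ?_ hcount
      have h1 : ρ * ((L + 1 : ℕ) : ℝ) + 1 < ε * L' := by
        have h2 : ε * (L * c / γ) ≤ ε * L' := by gcongr
        have h3 : ε * (L * c / γ) = 4 * ρ * L := by simp only [ρ]; field_simp
        have h4 : 1 ≤ ρ * N₁ := by
          simp only [ρ]
          rw [div_mul_eq_mul_div, le_div_iff₀ (by positivity)]
          linarith
        have h5 : ρ * (N₁ + 1) ≤ ρ * L := by gcongr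
        have h6 : ρ * 1 ≤ ρ * L := by gcongr
        push_cast
        linarith
      linarith
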